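/- Assume $\mathrm{GCH}$, i.e. $2^{\mu}=\mu^{+}$ for every infinite cardinal $\mu$. For a regular uncountable cardinal $\mu$ and a simple undirected graph $X$ (finite or infinite), say that $X$ is stationary list colorable for $\mu$, written $\mathsf{SList}(X,\mu)$, if for every function $L$ assigning to each vertex $v$ of $X$ a stationary subset $L(v)\subseteq\mu$ there is a function $c$ with $c(v)\in L(v)$ for all vertices $v$ and $c(v)\neq c(w)$ whenever $v$ and $w$ are adjacent. For a regular cardinal $\nu$ let $I[\nu]$ be the set of all $S\subseteq\nu$ for which there are a sequence $\langle b_\xi \mid \xi<\nu\rangle$ of bounded subsets of $\nu$ and a club $C\subseteq\nu$ such that for every $\gamma\in C\cap S$ there is a cofinal set $c_\gamma\subseteq\gamma$ of order type $\mathrm{cf}(\gamma)$ such that for every $\delta<\gamma$ there is $\eta<\gamma$ with $c_\gamma\cap\delta=b_\eta$. Let $\kappa$ be a regular uncountable cardinal and $X$ a graph. Then: 1. $\mathsf{SList}(X,\kappa)$ implies $\mathsf{SList}(X,\kappa^{++})$. 2. If $\nu\in I[\nu]$ for all regular cardinals $\nu$, then $\mathsf{SList}(X,\kappa)$ implies $\mathsf{SList}(X,\kappa^{+})$.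 -/

import Mathlib

universe u

/-- The generalized continuum hypothesis: `2 ^ μ = μ⁺` for every infinite cardinal `μ`. -/
def GCH : Prop :=
  ∀ μ : Cardinal.{u}, Cardinal.aleph0 ≤ μ → (2 : Cardinal.{u}) ^ μ = Order.succ μ

/-- `X` is stationary list colorable for `κ` (used for regular uncountable `κ`): every assignment
`L` of stationary subsets of `κ` to the vertices admits a choice function that is a proper
coloring. The well-order `κ.ord.ToType` has order type `κ` and stands for the set of ordinals
below `κ`. -/
def StationaryListColorable {V : Type u} (X : SimpleGraph V) (κ : Cardinal.{u}) : Prop :=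
  ∀ L : V → Set κ.ord.ToType, (∀ v, IsStationary (L v)) →
    ∃ c : X.Coloring κ.ord.ToType, ∀ v, c v ∈ L v

/-- The ideal `I[α]` of approachable subsets of a well-order `α`; for a regular cardinal `ν`, the
ideal `I[ν]` is the case `α = ν.ord.ToType`. A point `γ` is identified with the initial segment
`Set.Iio γ`, so that `Order.cof (Set.Iio γ)` is the cofinality of `γ`. -/
def approachabilityIdeal (α : Type u) [LinearOrder α] [WellFoundedLT α] : Set (Set α) :=
  {S | ∃ (b : α → Set α) (C : Set α), (∀ ξ, BddAbove (b ξ)) ∧ IsClub C ∧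
    ∀ γ ∈ C ∩ S, ∃ c : Set α, c ⊆ Set.Iio γ ∧
      (∀ δ < γ, ∃ ε ∈ c, δ ≤ ε) ∧
      Ordinal.type (fun x y : c => x < y) = (Order.cof (Set.Iio γ)).ord ∧
      ∀ δ < γ, ∃ η < γ, c ∩ Set.Iio δ = b η}

/-- Every regular cardinal `ν` satisfies `ν ∈ I[ν]`. -/
def ApproachabilityAssumption : Prop :=
  ∀ ν : Cardinal.{u}, ν.IsRegular → Set.univ ∈ approachabilityIdeal ν.ord.ToType

section

open Cardinal Order Set

namespace StatList

/-! Colorability for `κ` limits how many vertices can have more than `κ` neighbours in a given set.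
A Sierpiński family of `κ` maps from `κ⁺` to the clubs of `κ` provides lists on `A` such that,
whatever the coloring, many outside vertices see a stationary set of colors on their neighbours in
`A`. If there are `2 ^ #A` such vertices, their lists can anticipate every coloring of `A`, which is
absurd (`not_many_rich`). With GCH and induction on `#A`, at most `#A` vertices outside `A` have
more than `κ` neighbours in `A` (`card_rich_le`). Filtrations by closed sets then yield a
well-founded orientation with at most `κ⁺` lower neighbours at each vertex (`exists_orientation`).
Stationary subsets of `κ⁺⁺` have size `κ⁺⁺`, so greedy coloring proves the first claim.

For `κ⁺` the lists are no larger than the lower neighbourhoods. Each list is therefore thinned to a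
ladder: an unbounded set without limits inside itself. If the ladders over a set `N` of vertices
have, above each `t`, at most `κ` distinct first elements, then by Fodor their union is
nonstationary (`not_isStationary_of_thin`), and a later ladder can be chosen with bounded
intersection with it (`exists_ladder`). The aim is a partition into cells of size at most `κ⁺` such
that each ladder meets the ladders of lower neighbours in other cells in a bounded set. Then colors
are taken above the bound and injectively on each cell.

Approachability enters through `exists_club_thin`: on a club of initial segments, no later vertex
sees more than `κ` values of a given map to `κ⁺` on its neighbours in the segment. It rests on
`star_core`, a stationary version of the anticipation argument. Induction on cardinality turns this
into partitions with small classes for a given ladder system (`thinPartition`).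

The ladders must in turn know the partition. This circle is broken by `κ⁺⁺` stages of growing
equivalence relations, along which the ladder at each vertex stabilizes (`exists_stable_system`).
Limit classes may have size `κ⁺⁺`; one more application of `exists_club_thin` cuts them into cells.
-/

theorem exists_least {α : Type*} [LinearOrder α] [WellFoundedLT α] {P : α → Prop}
    (h : ∃ a, P a) : ∃ a, P a ∧ ∀ b, P b → a ≤ b :=
  ⟨_, WellFounded.min_mem wellFounded_lt {a | P a} h, fun _ hb ↦
    not_lt.1 (WellFounded.not_lt_min wellFounded_lt {a | P a} hb)⟩

/-! ### Clubs, stationary sets and Fodor's lemma in a regular well-order. -/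

/-- `α` is a well-order of order type the regular uncountable cardinal `μ`, in terms of
cardinalities. -/
structure RegularOrder (μ : Cardinal.{u}) (α : Type u) [LinearOrder α] [WellFoundedLT α] :
    Prop where
  unc : ℵ₀ < μ
  reg : μ.IsRegular
  cof_eq : Order.cof α = μ
  card_eq : #α = μ
  card_Iio : ∀ a : α, #(Iio a) < μ

theorem regularOrder_toType {μ : Cardinal.{u}} (hμ : μ.IsRegular) (h : ℵ₀ < μ) :
    RegularOrder μ μ.ord.ToType where
  unc := h
  reg := hμ
  cof_eq := by rw [Ordinal.cof_toType, hμ.cof_ord]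
  card_eq := mk_ord_toType μ
  card_Iio a := (mk_Iio_lt a (by simp)).trans_eq (mk_ord_toType μ)

namespace RegularOrder

variable {μ : Cardinal.{u}} {α : Type u} [LinearOrder α] [WellFoundedLT α]

theorem nonempty (h : RegularOrder μ α) : Nonempty α := by
  rw [← mk_ne_zero_iff, h.card_eq]
  exact h.reg.ne_zero

theorem cof_ne (h : RegularOrder μ α) : Order.cof α ≠ ℵ₀ := by
  rw [h.cof_eq]; exact h.unc.ne'

theorem exists_ge (h : RegularOrder μ α) {s : Set α} (hs : #s < μ) : ∃ b, ∀ a ∈ s, a ≤ b := by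
  have := BddAbove.of_not_isCofinal (s := s) fun hc ↦ (cof_le hc).not_gt (h.cof_eq ▸ hs)
  exact this

theorem card_Iic (h : RegularOrder μ α) (a : α) : #(Iic a) < μ := by
  rw [← Iio_insert]
  exact (mk_insert_le).trans_lt (add_lt_of_lt h.reg.1 (h.card_Iio a)
    (one_lt_aleph0.trans h.unc))

theorem exists_gt' (h : RegularOrder μ α) (a : α) : ∃ b, a < b := by
  by_contra! hb
  have : Iic a = Set.univ := eq_univ_of_forall hb
  have h2 := h.card_Iic a
  rw [this, mk_univ, h.card_eq] at h2
  exact h2.ne rfl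

theorem exists_gt (h : RegularOrder μ α) {s : Set α} (hs : #s < μ) : ∃ b, ∀ a ∈ s, a < b := by
  obtain ⟨b, hb⟩ := h.exists_ge hs
  obtain ⟨c, hc⟩ := h.exists_gt' b
  exact ⟨c, fun a ha ↦ (hb a ha).trans_lt hc⟩

theorem exists_gt_range (h : RegularOrder μ α) {ι : Type u} (hι : #ι < μ) (f : ι → α) :
    ∃ b, ∀ i, f i < b := by
  obtain ⟨b, hb⟩ := h.exists_gt (s := range f) (mk_range_le.trans_lt hι)
  exact ⟨b, fun i ↦ hb _ ⟨i, rfl⟩⟩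

theorem card_lt_of_le (h : RegularOrder μ α) {s : Set α} {b : α} (hb : ∀ a ∈ s, a ≤ b) : #s < μ :=
  (mk_le_mk_of_subset (t := Iic b) hb).trans_lt (h.card_Iic b)

theorem isClub_inter (h : RegularOrder μ α) {s t : Set α} (hs : IsClub s) (ht : IsClub t) :
    IsClub (s ∩ t) := hs.inter h.cof_ne ht

theorem isClub_iInter (h : RegularOrder μ α) {ι : Type u} (hι : #ι < μ) {C : ι → Set α}
    (hC : ∀ i, IsClub (C i)) : IsClub (⋂ i, C i) :=
  .iInter h.cof_ne (by rw [h.cof_eq]; simpa using hι) hC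

theorem isClub_iff_isLUB {α : Type*} [LinearOrder α] {s : Set α} :
    IsClub s ↔ (∀ t ⊆ s, t.Nonempty → ∀ x, IsLUB t x → x ∈ s) ∧ ∀ a, ∃ b ∈ s, a ≤ b :=
  ⟨fun hs ↦ ⟨fun _ ht h0 _ hx ↦ hs.isLUB_mem ht h0 hx, hs.isCofinal⟩,
    fun hs ↦ ⟨fun _ ht h0 _ _ hx ↦ hs.1 _ ht h0 _ hx, hs.2⟩⟩

theorem isClub_Ioi (h : RegularOrder μ α) (a : α) : IsClub (Ioi a) := by
  refine isClub_iff_isLUB.2 ⟨fun t ht ⟨y, hy⟩ x hx ↦ (ht hy).trans_le (hx.1 hy), fun b ↦ ?_⟩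
  obtain ⟨c, hc⟩ := h.exists_gt' (max a b)
  exact ⟨c, (le_max_left _ _).trans_lt hc, (le_max_right _ _).trans hc.le⟩

theorem exists_isLUB {s : Set α} {b : α} (hb : ∀ a ∈ s, a ≤ b) : ∃ x, IsLUB s x :=
  exists_least ⟨b, hb⟩

/-- Diagonal intersections of clubs are clubs. -/
theorem isClub_diag (h : RegularOrder μ α) {C : α → Set α} (hC : ∀ a, IsClub (C a)) :
    IsClub {d | ∀ a < d, d ∈ C a} := by
  refine isClub_iff_isLUB.2 ⟨fun t ht _ x hx a hax ↦ ?_, fun a ↦ ?_⟩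
  · obtain ⟨y, hy, hay⟩ := (lt_isLUB_iff hx).1 hax
    refine (hC a).isLUB_mem (t := t ∩ Ioi a) (fun z hz ↦ ht hz.1 a hz.2) ⟨y, hy, hay⟩ ⟨?_, ?_⟩
    · exact fun z hz ↦ hx.1 hz.1
    · intro b hb
      refine hx.2 fun z hz ↦ ?_
      by_cases haz : a < z
      · exact hb ⟨hz, haz⟩
      · exact (not_lt.1 haz).trans (hay.le.trans (hb ⟨hy, hay⟩))
  · have hnext : ∀ b : α, ∃ c, b < c ∧ ∀ a < b, c ∈ C a := by
      intro b
      have h1 : IsClub (⋂ a : Iio b, C a) := h.isClub_iInter (h.card_Iio b) fun a ↦ hC a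
      obtain ⟨c, hc, hbc⟩ := (h.isClub_inter h1 (h.isClub_Ioi b)).isCofinal b
      exact ⟨c, hc.2, fun a ha ↦ mem_iInter.1 hc.1 ⟨a, ha⟩⟩
    choose g hg1 hg2 using hnext
    -- The supremum of `ω` iterates of `g` lies in the diagonal intersection: past any `c` below it,
    -- all further iterates are in `C c`.
    let s : ℕ → α := fun n ↦ g^[n] a
    have hs : ∀ n, s (n + 1) = g (s n) := fun n ↦ Function.iterate_succ_apply' g n a
    have hmono : StrictMono s := strictMono_nat_of_lt_succ fun n ↦ by rw [hs]; exact hg1 _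
    obtain ⟨b, hb⟩ := h.exists_ge (s := range s)
      ((le_aleph0_iff_set_countable.2 (countable_range s)).trans_lt h.unc)
    obtain ⟨x, hx⟩ := exists_isLUB hb
    refine ⟨x, fun c hcx ↦ ?_, hx.1 ⟨0, rfl⟩⟩
    obtain ⟨_, ⟨n, rfl⟩, hcn⟩ := (lt_isLUB_iff hx).1 hcx
    refine (hC c).isLUB_mem (t := s '' Ioi n) ?_ ⟨_, n + 1, by simp, rfl⟩ ⟨?_, ?_⟩
    · rintro _ ⟨m, hm, rfl⟩
      obtain ⟨m, rfl⟩ : ∃ k, m = k + 1 := ⟨m - 1, by simp at hm; omega⟩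
      rw [hs]
      refine hg2 _ _ (hcn.trans_le (hmono.monotone ?_))
      simp at hm; omega
    · rintro _ ⟨m, -, rfl⟩; exact hx.1 ⟨m, rfl⟩
    · intro z hz
      refine hx.2 ?_
      rintro _ ⟨m, rfl⟩
      exact (hmono.monotone (by omega : m ≤ m + n + 1)).trans (hz ⟨m + n + 1, by simp, rfl⟩)

theorem isClub_closed (h : RegularOrder μ α) (f : α → α) : IsClub {d | ∀ a < d, f a < d} :=
  h.isClub_diag (C := fun a ↦ Ioi (f a)) fun a ↦ h.isClub_Ioi (f a)

theorem isClub_limit (h : RegularOrder μ α) : IsClub {d : α | ∀ a < d, ∃ b, a < b ∧ b < d} := by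
  choose g hg using h.exists_gt'
  have := h.isClub_closed g
  refine isClub_iff_isLUB.2 ⟨fun t ht h0 x hx a hax ↦ ?_, fun a ↦ ?_⟩
  · obtain ⟨y, hy, hay⟩ := (lt_isLUB_iff hx).1 hax
    obtain ⟨b, hb, hb'⟩ := ht hy a hay
    exact ⟨b, hb, hb'.trans_le (hx.1 hy)⟩
  · obtain ⟨b, hb, hab⟩ := this.isCofinal a
    exact ⟨b, fun c hc ↦ ⟨g c, hg c, hb c hc⟩, hab⟩

/-- Fodor's lemma, for a relation. -/
theorem fodor (h : RegularOrder μ α) {S : Set α} (hS : IsStationary S) {P : α → α → Prop}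
    (hP : ∀ d ∈ S, ∃ a < d, P a d) : ∃ a, IsStationary {d ∈ S | P a d} := by
  by_contra! hcon
  simp_rw [not_isStationary_iff] at hcon
  choose C hC hd using hcon
  obtain ⟨d, hdS, hdC⟩ := hS (h.isClub_diag hC)
  obtain ⟨a, had, hP'⟩ := hP d hdS
  exact disjoint_left.1 (hd a) ⟨hdS, hP'⟩ (hdC a had)

theorem stationary_pigeonhole (h : RegularOrder μ α) {S : Set α} (hS : IsStationary S)
    {ι : Type u} (hι : #ι < μ) {P : ι → α → Prop} (hP : ∀ d ∈ S, ∃ i, P i d) :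
    ∃ i, IsStationary {d ∈ S | P i d} := by
  rw [← isStationary_iUnion_iff h.cof_ne (by rw [h.cof_eq]; simpa using hι)]
  refine hS.mono fun d hd ↦ ?_
  obtain ⟨i, hi⟩ := hP d hd
  exact mem_iUnion.2 ⟨i, hd, hi⟩

theorem stationary_inter (h : RegularOrder μ α) {S C : Set α} (hS : IsStationary S)
    (hC : IsClub C) : IsStationary (S ∩ C) := by
  intro t ht
  rw [inter_assoc]
  exact hS (h.isClub_inter hC ht)

theorem stationary_exists_gt (h : RegularOrder μ α) {S : Set α} (hS : IsStationary S) (a : α) :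
    ∃ d ∈ S, a < d := by
  obtain ⟨d, hd, hd'⟩ := hS (h.isClub_Ioi a)
  exact ⟨d, hd, hd'⟩

theorem card_of_cofinal (h : RegularOrder μ α) {S : Set α} (hS : ∀ a, ∃ d ∈ S, a < d) :
    #S = μ := by
  refine le_antisymm ((mk_set_le S).trans h.card_eq.le) (not_lt.1 fun hlt ↦ ?_)
  obtain ⟨b, hb⟩ := h.exists_gt hlt
  obtain ⟨d, hd, hbd⟩ := hS b
  exact (hb d hd).not_gt hbd

theorem card_of_stationary (h : RegularOrder μ α) {S : Set α} (hS : IsStationary S) : #S = μ :=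
  h.card_of_cofinal (h.stationary_exists_gt hS)

theorem club_stationary (h : RegularOrder μ α) {C : Set α} (hC : IsClub C) : IsStationary C :=
  have := h.nonempty
  hC.isStationary h.cof_ne

/-- A club contains the largest of its elements below a given point. -/
theorem club_exists_max {D : Set α} (hD : IsClub D) {t d : α} (hd : d ∈ D) (hdt : d ≤ t) :
    ∃ m ∈ D, m ≤ t ∧ d ≤ m ∧ ∀ e ∈ D, e ≤ t → e ≤ m := by
  obtain ⟨x, hx⟩ := exists_isLUB (s := D ∩ Iic t) (b := t) fun a ha ↦ ha.2
  exact ⟨x, hD.isLUB_mem inter_subset_left ⟨d, hd, hdt⟩ hx, hx.2 fun a ha ↦ ha.2, hx.1 ⟨hd, hdt⟩,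
    fun e he het ↦ hx.1 ⟨he, het⟩⟩

theorem card_iUnion_lt (h : RegularOrder μ α) {ι β : Type u} (hι : #ι < μ) {t : ι → Set β}
    (ht : ∀ i, #(t i) < μ) : #(⋃ i, t i) < μ :=
  (card_iUnion_lt_iff_forall_of_isRegular h.reg hι).2 ht

end RegularOrder

/-! ### Well-founded recursion and greedy choice. -/

/-- Recursion along a well-founded relation producing values with a property relative to earlier
values. -/
theorem exists_rec {ι : Type*} {β : Type*} [Nonempty β] {r : ι → ι → Prop} (hr : WellFounded r)
    {P : ι → (ι → β) → β → Prop}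
    (hloc : ∀ i f g b, (∀ j, r j i → f j = g j) → P i f b → P i g b)
    (hex : ∀ i f, ∃ b, P i f b) : ∃ f : ι → β, ∀ i, P i f (f i) := by
  classical
  choose F hF using hex
  let f : ι → β := hr.fix fun i h ↦ F i fun j ↦ if hj : r j i then h j hj else Classical.arbitrary β
  refine ⟨f, fun i ↦ ?_⟩
  have : f i = F i fun j ↦ if r j i then f j else Classical.arbitrary β := by
    simp only [f]
    rw [hr.fix_eq]
    simp
  rw [this]
  refine hloc i _ _ _ (fun j hj ↦ ?_) (hF i _)
  simp [hj]

/-- Greedy choice of values that avoid the values chosen at smaller points. -/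
theorem exists_greedy {ι β : Type u} {r : ι → ι → Prop} (hr : WellFounded r) (Q : ι → Set β)
    (hQ : ∀ x, #{y | r y x} < #(Q x)) :
    ∃ c : ι → β, ∀ x, c x ∈ Q x ∧ ∀ y, r y x → c y ≠ c x := by
  cases isEmpty_or_nonempty β
  · refine ⟨fun i ↦ False.elim ?_, fun i ↦ False.elim ?_⟩ <;>
    · have := hQ i
      rw [Set.eq_empty_of_isEmpty (Q i)] at this
      simp at this
  refine exists_rec hr (P := fun x c b ↦ b ∈ Q x ∧ ∀ y, r y x → c y ≠ b) ?_ ?_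
  · intro i f g b hfg h
    exact ⟨h.1, fun y hy ↦ hfg y hy ▸ h.2 y hy⟩
  · intro i f
    have : ¬ Q i ⊆ f '' {y | r y i} := fun hsub ↦
      ((mk_le_mk_of_subset hsub).trans mk_image_le).not_gt (hQ i)
    obtain ⟨b, hb, hb'⟩ := Set.not_subset.1 this
    exact ⟨b, hb, fun y hy h ↦ hb' ⟨y, hy, h⟩⟩

/-! ### Few vertices have many neighbours in a given set. -/

section
theorem card_iUnion_le {ι β : Type u} {c : Cardinal.{u}} (hc : ℵ₀ ≤ c) {f : ι → Set β}
    (hι : #ι ≤ c) (hf : ∀ i, #(f i) ≤ c) : #(⋃ i, f i) ≤ c :=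
  (mk_iUnion_le f).trans <| (mul_le_mul' hι (ciSup_le' hf)).trans (mul_eq_self hc).le

theorem card_biUnion_le {ι β : Type u} {c : Cardinal.{u}} (hc : ℵ₀ ≤ c) {t : Set ι}
    {f : ι → Set β} (ht : #t ≤ c) (hf : ∀ i ∈ t, #(f i) ≤ c) : #(⋃ i ∈ t, f i) ≤ c := by
  rw [biUnion_eq_iUnion]
  exact card_iUnion_le hc ht fun i ↦ hf i i.2

theorem card_union_le {β : Type u} {c : Cardinal.{u}} (hc : ℵ₀ ≤ c) {s t : Set β}
    (hs : #s ≤ c) (ht : #t ≤ c) : #(s ∪ t : Set β) ≤ c :=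
  (mk_union_le s t).trans (add_le_of_le hc hs ht)

theorem card_le_of_fibers {β γ : Type u} {c : Cardinal.{u}} (hc : ℵ₀ ≤ c) {s : Set β} (f : β → γ)
    (h1 : #(f '' s) ≤ c) (h2 : ∀ x ∈ s, #{y ∈ s | f y = f x} ≤ c) : #s ≤ c := by
  have : s ⊆ ⋃ z ∈ f '' s, {y ∈ s | f y = z} := fun x hx ↦ by
    simp only [mem_iUnion]
    exact ⟨f x, ⟨x, hx, rfl⟩, hx, rfl⟩
  refine (mk_le_mk_of_subset this).trans (card_biUnion_le hc h1 ?_)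
  rintro _ ⟨x, hx, rfl⟩
  exact h2 x hx

/-- An uncountable regular cardinal below which the combinatorics takes place, under GCH. -/
structure Ambient (κ : Cardinal.{u}) : Prop where
  gch : GCH.{u}
  reg : κ.IsRegular
  unc : ℵ₀ < κ

/-- The successor cardinal of `κ` as a well-order. -/
abbrev T (κ : Cardinal.{u}) : Type u := (succ κ).ord.ToType

namespace Ambient
variable {κ : Cardinal.{u}}

theorem reg' (hA : Ambient κ) : (succ κ).IsRegular := isRegular_succ hA.reg.1
theorem unc' (hA : Ambient κ) : ℵ₀ < succ κ := hA.unc.trans (lt_succ κ)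
theorem roκ (hA : Ambient κ) : RegularOrder κ κ.ord.ToType := regularOrder_toType hA.reg hA.unc
theorem roT (hA : Ambient κ) : RegularOrder (succ κ) (T κ) := regularOrder_toType hA.reg' hA.unc'
theorem inf (hA : Ambient κ) : ℵ₀ ≤ κ := hA.reg.1
theorem inf' (hA : Ambient κ) : ℵ₀ ≤ succ κ := hA.reg'.1

theorem two_power (hA : Ambient κ) : (2 : Cardinal.{u}) ^ κ = succ κ := hA.gch κ hA.inf

end Ambient

/-- Sierpiński's family of maps: one of them maps a given large set onto everything. -/
theorem exists_sierpinski {κ : Cardinal.{u}} (hA : Ambient κ) {I W : Type u} [Nonempty W]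
    (hI : #I = κ) (hW : #W ≤ succ κ) :
    ∃ Φ : I → T κ → W, ∀ H : Set (T κ), succ κ ≤ #H → ∃ i, ∀ w, ∃ t ∈ H, Φ i t = w := by
  have hcard : #(I → W) ≤ #(T κ) := by
    rw [hA.roT.card_eq, ← power_def, hI]
    refine (power_le_power_right hW).trans ?_
    rw [← hA.two_power, ← power_mul, mul_eq_self hA.inf]
  have : Nonempty I := by rw [← mk_ne_zero_iff, hI]; exact hA.reg.ne_zero
  have : Nonempty (T κ) := hA.roT.nonempty
  obtain ⟨q, hq⟩ : ∃ q : T κ → (I → W), Function.Surjective q := by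
    obtain ⟨e⟩ := hcard
    exact ⟨Function.invFun e, Function.invFun_surjective e.injective⟩
  have hd : ∀ t : T κ, ∃ d : I → T κ, ∀ s < t, ∃ i, d i = s := by
    intro t
    have : #(Iio t) ≤ #I := by rw [hI]; exact lt_succ_iff.1 (hA.roT.card_Iio t)
    obtain ⟨e⟩ := this
    cases isEmpty_or_nonempty (Iio t)
    · exact ⟨Classical.arbitrary _, fun s hs ↦ isEmptyElim (⟨s, hs⟩ : Iio t)⟩
    · exact ⟨fun i ↦ (Function.invFun e i : Iio t), fun s hs ↦
        ⟨e ⟨s, hs⟩, congrArg Subtype.val (Function.leftInverse_invFun e.injective ⟨s, hs⟩)⟩⟩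
  choose d hd using hd
  -- If every `Φ i` misses a value `w i` on `H`, then `w` is `q t₀` for some `t₀`. Any `t ∈ H` above
  -- `t₀` has `t₀ = d t i` for some `i`, and there `Φ i t = w i`.
  refine ⟨fun i t ↦ q (d t i) i, fun H hH ↦ ?_⟩
  by_contra! hcon
  choose w hw using hcon
  obtain ⟨t₀, ht₀⟩ := hq w
  obtain ⟨t, htH, ht⟩ : ∃ t ∈ H, t₀ < t := by
    by_contra! hb
    exact (hA.roT.card_lt_of_le hb).not_ge hH
  obtain ⟨i, hi⟩ := hd t t₀ ht
  exact hw i t htH (by rw [hi, ht₀])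

/-- Club subsets of `κ`. -/
abbrev Clubs (κ : Cardinal.{u}) : Type u := {C : Set κ.ord.ToType // IsClub C}

instance (κ : Cardinal.{u}) : Nonempty (Clubs κ) := ⟨⟨Set.univ, .univ⟩⟩

theorem Ambient.card_set {κ : Cardinal.{u}} (hA : Ambient κ) :
    #(Set κ.ord.ToType) = succ κ := by
  rw [mk_set, mk_ord_toType, hA.two_power]

variable {κ : Cardinal.{u}} {V : Type u} {X : SimpleGraph V}

/-- By pigeonhole one Sierpiński map `Φ i` works for `2 ^ #A` vertices of `B`. With lists `Φ i (G
a)` on `A`, every coloring puts a stationary set of colors on the neighbours in `A` of such a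
vertex, since every club occurs as the list of some neighbour. As there are only `2 ^ #A` maps from
`A` to `κ`, each is the guess of one of these vertices, whose list consists of the colors guessed
for its neighbours. The vertex that guesses correctly has no color. -/
theorem not_many_rich (hA : Ambient κ) (hX : StationaryListColorable X κ) {A B : Set V}
    (hAB : ∀ v ∈ B, v ∉ A) (G : V → T κ)
    (hG : ∀ v ∈ B, succ κ ≤ #(G '' (X.neighborSet v ∩ A))) (hB : 2 ^ #A ≤ #B) : False := by
  classical
  have hκA : succ κ ≤ #A := by
    have : B.Nonempty := by
      rw [← mk_set_ne_zero_iff]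
      exact ((pos_iff_ne_zero.2 (power_ne_zero _ two_ne_zero)).trans_le hB).ne'
    obtain ⟨v, hv⟩ := this
    exact (hG v hv).trans (mk_image_le.trans (mk_le_mk_of_subset inter_subset_right))
  have hinf : ℵ₀ ≤ #A := hA.inf'.trans hκA
  obtain ⟨Φ, hΦ⟩ := exists_sierpinski hA (I := κ.ord.ToType) (W := Clubs κ) (mk_ord_toType κ)
    ((mk_subtype_le _).trans hA.card_set.le)
  have hi : ∀ v ∈ B, ∃ i, ∀ w, ∃ t ∈ G '' (X.neighborSet v ∩ A), Φ i t = w :=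
    fun v hv ↦ hΦ _ (hG v hv)
  obtain ⟨i, hi⟩ : ∃ i, 2 ^ #A ≤ #{v ∈ B | ∀ w, ∃ t ∈ G '' (X.neighborSet v ∩ A), Φ i t = w} := by
    by_contra! hcon
    rw [hA.gch _ hinf] at hcon hB
    refine (succ_le_iff.1 hB).not_ge ?_
    have : B ⊆ ⋃ i, {v ∈ B | ∀ w, ∃ t ∈ G '' (X.neighborSet v ∩ A), Φ i t = w} := fun v hv ↦ by
      obtain ⟨i, h⟩ := hi v hv
      exact mem_iUnion.2 ⟨i, hv, h⟩
    refine (mk_le_mk_of_subset this).trans (card_iUnion_le hinf ?_ fun i ↦ lt_succ_iff.1 (hcon i))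
    rw [mk_ord_toType]
    exact (lt_succ κ).le.trans hκA
  set B' := {v ∈ B | ∀ w, ∃ t ∈ G '' (X.neighborSet v ∩ A), Φ i t = w} with hB'
  have : Nonempty κ.ord.ToType := hA.roκ.nonempty
  obtain ⟨f, hf⟩ : ∃ f : B' → (A → κ.ord.ToType), Function.Surjective f := by
    have : #(A → κ.ord.ToType) ≤ #B' := by
      rw [← power_def, mk_ord_toType]
      refine le_trans ?_ hi
      rw [power_eq_two_power hinf (natCast_lt_aleph0 (n := 2) |>.le.trans hA.inf)
        ((lt_succ κ).le.trans hκA)]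
    obtain ⟨e⟩ := this
    exact ⟨Function.invFun e, Function.invFun_surjective e.injective⟩
  let S : B' → Set κ.ord.ToType := fun v ↦ f v '' {a | a.1 ∈ X.neighborSet v.1}
  let L : V → Set κ.ord.ToType := fun v ↦
    if hv : v ∈ B' then (if IsStationary (S ⟨v, hv⟩) then S ⟨v, hv⟩ else Set.univ)
    else Φ i (G v)
  have hL : ∀ v, IsStationary (L v) := by
    intro v
    simp only [L]
    split_ifs with h1 h2
    · exact h2
    · exact .univ
    · exact hA.roκ.club_stationary (Φ i (G v)).2
  obtain ⟨c, hc⟩ := hX L hL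
  obtain ⟨b, hb⟩ := hf fun a ↦ c a
  have hS : IsStationary (S b) := by
    intro C hC
    obtain ⟨_, ⟨a, ⟨hab, haA⟩, rfl⟩, ht⟩ := b.2.2 ⟨C, hC⟩
    refine ⟨c a, ⟨⟨a, haA⟩, hab, by rw [hb]⟩, ?_⟩
    have := hc a
    have haB : a ∉ B' := fun h ↦ hAB a h.1 haA
    simp only [L, haB, dite_false, ht] at this
    exact this
  have := hc b
  simp only [L, b.2, dite_true, hS, if_true] at this
  obtain ⟨a, hab, heq⟩ := this
  rw [hb] at heq
  exact c.valid hab heq.symm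

/-- A set of vertices has at most as many vertices with more than `κ` neighbours in it as it has
elements. -/
theorem card_rich_le (hA : Ambient κ) (hX : StationaryListColorable X κ) (A : Set V) :
    #{v | v ∉ A ∧ succ κ ≤ #(X.neighborSet v ∩ A : Set V)} ≤ #A := by
  classical
  -- In a minimal counterexample, discarding the vertices that are rich over some proper initial
  -- segment of `A` costs only `#A` vertices. The others have at most `κ` neighbours in each proper
  -- segment but more than `κ` in `A`.
  induction hρ : #A using WellFoundedLT.induction generalizing A with | _ ρ ih
  by_contra! hlt
  set B := {v | v ∉ A ∧ succ κ ≤ #(X.neighborSet v ∩ A : Set V)} with hB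
  have hKρ : succ κ ≤ ρ := by
    have : B.Nonempty := by
      rw [← mk_set_ne_zero_iff]
      exact (zero_le.trans_lt hlt).ne'
    obtain ⟨v, hv⟩ := this
    rw [← hρ]
    exact hv.2.trans (mk_le_mk_of_subset inter_subset_right)
  have hinf : ℵ₀ ≤ ρ := hA.inf'.trans hKρ
  obtain ⟨e⟩ : Nonempty (A ≃ ρ.ord.ToType) := Cardinal.eq.1 (by rw [hρ, mk_ord_toType])
  have : Nonempty ρ.ord.ToType := by
    rw [← mk_ne_zero_iff, mk_ord_toType]; exact (aleph0_pos.trans_le hinf).ne'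
  let idx : V → ρ.ord.ToType := fun v ↦ if h : v ∈ A then e ⟨v, h⟩ else Classical.arbitrary _
  have hidx : ∀ i, #{a ∈ A | idx a < i} < ρ := by
    intro i
    have : #(Iio i) < ρ := (mk_Iio_lt i (by simp)).trans_eq (mk_ord_toType ρ)
    refine lt_of_le_of_lt ?_ this
    refine mk_le_of_injective (f := fun a ↦ ⟨idx a.1, a.2.2⟩) ?_
    rintro ⟨a, ha⟩ ⟨b, hb⟩ hab
    simp only [Subtype.mk.injEq, idx, ha.1, hb.1, dite_true, e.injective.eq_iff] at hab
    exact Subtype.ext hab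
  let Ai : ρ.ord.ToType → Set V := fun i ↦ {a ∈ A | idx a < i}
  let Bi : ρ.ord.ToType → Set V := fun i ↦
    {v | v ∉ Ai i ∧ succ κ ≤ #(X.neighborSet v ∩ Ai i : Set V)}
  have hBi : ∀ i, #(Bi i) ≤ ρ := fun i ↦ (ih _ (hidx i) (Ai i) rfl).trans (hidx i).le
  let B' := B \ ⋃ i, Bi i
  have hB' : ρ < #B' := by
    by_contra! hle
    refine hlt.not_ge ((mk_le_mk_of_subset (t := B' ∪ ⋃ i, Bi i) ?_).trans
      (card_union_le hinf hle (card_iUnion_le hinf (mk_ord_toType ρ).le hBi)))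
    intro v hv
    by_cases h : v ∈ ⋃ i, Bi i
    · exact Or.inr h
    · exact Or.inl ⟨hv, h⟩
  have hthin : ∀ v ∈ B', ∀ i, #(X.neighborSet v ∩ Ai i : Set V) ≤ κ := by
    intro v hv i
    by_contra! h
    exact hv.2 (mem_iUnion.2 ⟨i, fun h' ↦ hv.1.1 h'.1, succ_le_of_lt h⟩)
  obtain ⟨cs, hcof, hcs⟩ := exists_cof_eq (α := ρ.ord.ToType)
  have : NoMaxOrder ρ.ord.ToType := by
    refine ⟨fun a ↦ ?_⟩
    by_contra! hb
    have h1 : Iic a = Set.univ := eq_univ_of_forall hb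
    have h2 : #(Iic a) < ρ := by
      rw [← Iio_insert]
      exact (mk_insert_le).trans_lt (add_lt_of_lt hinf
        ((mk_Iio_lt a (by simp)).trans_eq (mk_ord_toType ρ)) (one_lt_aleph0.trans_le hinf))
    rw [h1, mk_univ, mk_ord_toType] at h2
    exact h2.ne rfl
  have hcover : ∀ a, ∃ i : cs, idx a < i := by
    intro a
    obtain ⟨b, hb⟩ := exists_gt (idx a)
    obtain ⟨i, hi, hbi⟩ := hcof b
    exact ⟨⟨i, hi⟩, hb.trans_le hbi⟩
  choose g hg using hcover
  have hBne : B'.Nonempty := by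
    rw [← mk_set_ne_zero_iff]
    exact (zero_le.trans_lt hB').ne'
  -- If the cofinality exceeded `κ⁺`, then `κ⁺` neighbours of `v` would already lie in a proper
  -- initial segment.
  have hcK : #cs ≤ succ κ := by
    obtain ⟨v, hv⟩ := hBne
    obtain ⟨N', hN', hN'c⟩ := le_mk_iff_exists_subset.1 hv.1.2
    by_contra! hc
    rw [hcs] at hc
    have hnc : ¬ IsCofinal (idx '' N') := fun h ↦
      (cof_le h).not_gt ((mk_image_le.trans hN'c.le).trans_lt hc)
    obtain ⟨b, hb⟩ := not_isCofinal_iff.1 hnc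
    refine (hthin v hv b).not_gt ((lt_succ κ).trans_le (hN'c.ge.trans (mk_le_mk_of_subset ?_)))
    intro a ha
    exact ⟨(hN' ha).1, (hN' ha).2, hb _ ⟨a, ha, rfl⟩⟩
  obtain ⟨j⟩ : Nonempty (cs ↪ T κ) := by
    have : #cs ≤ #(T κ) := by rwa [hA.roT.card_eq]
    exact this
  -- Points of `A` are labelled by an element of the cofinal set above them. Each label is shared by
  -- at most `κ` neighbours of `v`, so more than `κ` labels occur.
  refine not_many_rich hA hX (A := A) (B := B') (fun v hv ↦ hv.1.1) (fun a ↦ j (g a)) ?_ ?_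
  · intro v hv
    by_contra! hlt'
    refine (lt_succ κ).not_ge (hv.1.2.trans (card_le_of_fibers hA.inf (fun a ↦ j (g a))
      (lt_succ_iff.1 hlt') fun x hx ↦ (mk_le_mk_of_subset ?_).trans (hthin v hv (g x))))
    rintro y ⟨hy, hyx⟩
    exact ⟨hy.1, hy.2, j.injective hyx ▸ hg y⟩
  · rw [hρ, hA.gch _ hinf]
    exact succ_le_of_lt hB'

end

/-! ### Closed sets, orientations, and the case of `κ⁺⁺`. -/

section
variable {κ : Cardinal.{u}} {V : Type u} {X : SimpleGraph V}

/-- One closure step: add all vertices with more than `κ` neighbours in `A`, and apply `op`. -/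
def clStep (X : SimpleGraph V) (κ : Cardinal.{u}) (op : V → Set V) (A : Set V) : Set V :=
  A ∪ {v | succ κ ≤ #(X.neighborSet v ∩ A : Set V)} ∪ ⋃ a ∈ A, op a

theorem clStep_mono (op : V → Set V) {A B : Set V} (h : A ⊆ B) :
    clStep X κ op A ⊆ clStep X κ op B :=
  union_subset_union (union_subset_union h fun _ hv ↦
    le_trans hv (mk_le_mk_of_subset (inter_subset_inter_right _ h))) (biUnion_subset_biUnion_left h)

theorem card_clStep (hA : Ambient κ) (hX : StationaryListColorable X κ) {op : V → Set V}
    {c : Cardinal.{u}} (hop : ∀ x, #(op x) ≤ c) (hc : ℵ₀ ≤ c) {A : Set V} (hAc : #A ≤ c) :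
    #(clStep X κ op A) ≤ c := by
  have h1 := (card_rich_le hA hX A).trans hAc
  refine card_union_le hc ((mk_le_mk_of_subset (t := A ∪ _) ?_).trans (card_union_le hc hAc h1))
    (card_biUnion_le hc hAc fun x _ ↦ hop x)
  rintro v (hv | hv)
  · exact Or.inl hv
  · by_cases h : v ∈ A
    · exact Or.inl h
    · exact Or.inr ⟨h, hv⟩

/-- The closure of a set under `clStep`. -/
def cl (X : SimpleGraph V) (κ : Cardinal.{u}) (op : V → Set V) (A : Set V) : Set V :=
  ⋃ n : ℕ, (clStep X κ op)^[n] A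

theorem subset_cl (op : V → Set V) (A : Set V) : A ⊆ cl X κ op A :=
  subset_iUnion (fun n : ℕ ↦ (clStep X κ op)^[n] A) 0

theorem cl_mono (op : V → Set V) {A B : Set V} (h : A ⊆ B) : cl X κ op A ⊆ cl X κ op B := by
  refine iUnion_mono fun n ↦ ?_
  induction n with
  | zero => exact h
  | succ n ih =>
    rw [Function.iterate_succ_apply', Function.iterate_succ_apply']
    exact clStep_mono op ih

theorem card_iUnion_nat_le {β : Type u} {c : Cardinal.{u}} (hc : ℵ₀ ≤ c) {f : ℕ → Set β}
    (hf : ∀ n, #(f n) ≤ c) : #(⋃ n, f n) ≤ c := by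
  have : (⋃ n, f n) = ⋃ n : ULift.{u} ℕ, f n.down := by
    ext; simp [ULift.exists]
  rw [this]
  exact card_iUnion_le hc (by simpa using hc) fun n ↦ hf n.down

theorem card_cl (hA : Ambient κ) (hX : StationaryListColorable X κ) {op : V → Set V}
    {c : Cardinal.{u}} (hop : ∀ x, #(op x) ≤ c) (hc : ℵ₀ ≤ c) {A : Set V} (hAc : #A ≤ c) :
    #(cl X κ op A) ≤ c := by
  refine card_iUnion_nat_le hc fun n ↦ ?_
  induction n with
  | zero => exact hAc
  | succ n ih =>
    rw [Function.iterate_succ_apply']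
    exact card_clStep hA hX hop hc ih

/-- More than `κ` neighbours in a countable union means more than `κ` in one member, because `κ` is
infinite; the next member then absorbs the vertex. -/
theorem thin_of_notMem_iUnion (hA : Ambient κ) {op : V → Set V} {A : ℕ → Set V}
    (h : ∀ n, clStep X κ op (A n) ⊆ A (n + 1)) {v : V} (hv : v ∉ ⋃ n, A n) :
    #(X.neighborSet v ∩ ⋃ n, A n : Set V) ≤ κ := by
  rw [inter_iUnion]
  refine card_iUnion_nat_le hA.inf fun n ↦ ?_
  by_contra! hn
  exact hv (mem_iUnion.2 ⟨n + 1, h n (Or.inl (Or.inr (succ_le_of_lt hn)))⟩)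

theorem thin_of_notMem_cl (hA : Ambient κ) {op : V → Set V} {A : Set V} {v : V}
    (hv : v ∉ cl X κ op A) : #(X.neighborSet v ∩ cl X κ op A : Set V) ≤ κ :=
  thin_of_notMem_iUnion hA (fun n ↦ (Function.iterate_succ_apply' _ n A).ge) hv

/-- A subset of size `c⁺` cannot lie below any single `f y`, so the initial segments determined by
its points cover `S`. -/
theorem card_le_succ_of_chain {ι : Type*} [LinearOrder ι] {c : Cardinal.{u}} (hc : ℵ₀ ≤ c)
    {S : Set V} (f : V → ι) (hf : ∀ y ∈ S, #{z ∈ S | f z ≤ f y} ≤ c) : #S ≤ succ c := by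
  by_contra! hlt
  obtain ⟨S', hS', hcard⟩ := le_mk_iff_exists_subset.1 hlt.le
  refine hlt.not_ge ((mk_le_mk_of_subset (t := ⋃ y ∈ S', {z ∈ S | f z ≤ f y}) ?_).trans
    (card_biUnion_le (hc.trans (lt_succ c).le) hcard.le
      fun y hy ↦ (hf y (hS' hy)).trans (lt_succ c).le))
  intro y hy
  by_contra hcon
  simp only [mem_iUnion, not_exists] at hcon
  refine (lt_succ c).not_ge (hcard.ge.trans ((mk_le_mk_of_subset ?_).trans (hf y hy)))
  intro z hz
  refine ⟨hS' hz, le_of_not_ge fun h ↦ hcon z hz ⟨hy, h⟩⟩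

theorem wellFounded_lex {ι : Type*} [LinearOrder ι] [WellFoundedLT ι] (i : V → ι)
    {r : ι → V → V → Prop} (hr : ∀ j, WellFounded (r j)) :
    WellFounded fun x y ↦ i x < i y ∨ i x = i y ∧ r (i y) x y := by
  refine ⟨fun x ↦ ?_⟩
  induction hj : i x using WellFoundedLT.induction generalizing x with | _ j ih
  induction x using (hr j).induction with | _ x ih2
  refine ⟨_, fun y hy ↦ ?_⟩
  rcases hy with hy | ⟨hy, hy'⟩
  · exact ih _ (hj ▸ hy) y rfl
  · exact ih2 y (hj ▸ hy') (hy.trans hj)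

/-- Up to size `κ⁺⁺` any enumeration in minimal order type works. A larger `Y` is filtered by closed
sets, ordered by the first set in which a vertex appears, and inside each block by induction. A
vertex has at most `κ` neighbours in each earlier closed set, hence at most `κ⁺` in all of them
together; the filtration need not be continuous. -/
theorem exists_orientation_on (hA : Ambient κ) (hX : StationaryListColorable X κ) (Y : Set V) :
    ∃ r : V → V → Prop, WellFounded r ∧ (∀ x ∈ Y, ∀ y ∈ Y, x ≠ y → r x y ∨ r y x) ∧
      ∀ x ∈ Y, #{y ∈ Y | X.Adj x y ∧ r y x} ≤ succ κ := by
  classical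
  induction hρ : #Y using WellFoundedLT.induction generalizing Y with | _ ρ ih
  obtain ⟨e⟩ : Nonempty (Y ≃ ρ.ord.ToType) := Cardinal.eq.1 (by rw [hρ, mk_ord_toType])
  rcases isEmpty_or_nonempty ρ.ord.ToType with hemp | hne
  · have hY : Y = ∅ := by
      rw [← isEmpty_coe_sort]; exact e.isEmpty
    subst hY
    exact ⟨fun _ _ ↦ False, ⟨fun x ↦ ⟨_, fun y h ↦ h.elim⟩⟩, by simp, by simp⟩
  let idx : V → ρ.ord.ToType := fun v ↦ if h : v ∈ Y then e ⟨v, h⟩ else Classical.arbitrary _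
  have hinj : ∀ a ∈ Y, ∀ b ∈ Y, idx a = idx b → a = b := by
    intro a ha b hb hab
    simp only [idx, ha, hb, dite_true, e.injective.eq_iff] at hab
    exact congrArg Subtype.val hab
  have hidx : ∀ i, #{a ∈ Y | idx a < i} < ρ := by
    intro i
    have : #(Iio i) < ρ := (mk_Iio_lt i (by simp)).trans_eq (mk_ord_toType ρ)
    refine lt_of_le_of_lt ?_ this
    refine mk_le_of_injective (f := fun a ↦ ⟨idx a.1, a.2.2⟩) ?_
    rintro ⟨a, ha⟩ ⟨b, hb⟩ hab
    exact Subtype.ext (hinj a ha.1 b hb.1 (congrArg Subtype.val hab))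
  rcases le_or_gt ρ (succ (succ κ)) with hle | hlt
  · refine ⟨fun x y ↦ idx x < idx y, InvImage.wf idx wellFounded_lt, ?_, ?_⟩
    · intro x hx y hy hxy
      exact lt_or_gt_of_ne fun h ↦ hxy (hinj x hx y hy h)
    · intro x hx
      refine lt_succ_iff.1 (lt_of_lt_of_le (lt_of_le_of_lt (mk_le_mk_of_subset ?_) (hidx (idx x)))
        hle)
      exact fun y hy ↦ ⟨hy.1, hy.2.2⟩
  · have hKρ : succ κ < ρ := (lt_succ _).trans hlt
    have hinf := hA.inf'.trans hKρ.le
    let A : ρ.ord.ToType → Set V := fun i ↦ cl X κ (fun _ ↦ ∅) {a ∈ Y | idx a ≤ i}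
    have hmono : Monotone A := fun i j hij ↦ cl_mono _ fun a ha ↦ ⟨ha.1, ha.2.trans hij⟩
    have hAcard : ∀ i, #(A i) < ρ := by
      intro i
      have h1 : #{a ∈ Y | idx a ≤ i} < ρ := by
        refine (mk_le_mk_of_subset (t := {a ∈ Y | idx a < i} ∪ {a ∈ Y | idx a = i}) ?_).trans_lt
          ((mk_union_le _ _).trans_lt (add_lt_of_lt hinf (hidx i) ?_))
        · exact fun a ha ↦ ha.2.lt_or_eq.imp (⟨ha.1, ·⟩) (⟨ha.1, ·⟩)
        · refine lt_of_le_of_lt ?_ (one_lt_aleph0.trans_le hinf)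
          exact mk_le_one_iff_set_subsingleton.2 fun a ha b hb ↦
            hinj a ha.1 b hb.1 (ha.2.trans hb.2.symm)
      refine lt_of_le_of_lt (card_cl hA hX (c := max (succ κ) #{a ∈ Y | idx a ≤ i}) ?_
        (hA.inf'.trans (le_max_left _ _)) (le_max_right _ _)) (max_lt hKρ h1)
      simp
    have hex : ∀ v, ∃ i, v ∈ Y → v ∈ A i ∧ ∀ j < i, v ∉ A j := by
      intro v
      by_cases hv : v ∈ Y
      · obtain ⟨i, hi, hi'⟩ := exists_least (P := fun i ↦ v ∈ A i)
          ⟨idx v, subset_cl _ _ ⟨hv, le_rfl⟩⟩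
        exact ⟨i, fun _ ↦ ⟨hi, fun j hj hvj ↦ (hi' j hvj).not_gt hj⟩⟩
      · exact ⟨Classical.arbitrary _, fun h ↦ (hv h).elim⟩
    choose i hi using hex
    have hblock : ∀ j, #{v ∈ Y | i v = j} < ρ := fun j ↦
      (mk_le_mk_of_subset fun v hv ↦ hv.2 ▸ (hi v hv.1).1).trans_lt (hAcard j)
    choose r hr1 hr2 hr3 using fun j ↦ ih _ (hblock j) {v ∈ Y | i v = j} rfl
    refine ⟨_, wellFounded_lex i hr1, ?_, ?_⟩
    · intro x hx y hy hxy
      rcases lt_trichotomy (i x) (i y) with h | h | h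
      · exact Or.inl (Or.inl h)
      · rcases hr2 (i y) x ⟨hx, h⟩ y ⟨hy, rfl⟩ hxy with h' | h'
        · exact Or.inl (Or.inr ⟨h, h'⟩)
        · exact Or.inr (Or.inr ⟨h.symm, h ▸ h'⟩)
      · exact Or.inr (Or.inl h)
    · intro x hx
      refine (mk_le_mk_of_subset (t := {y ∈ Y | X.Adj x y ∧ i y < i x} ∪
        {y ∈ {v ∈ Y | i v = i x} | X.Adj x y ∧ r (i x) y x}) ?_).trans
        (card_union_le hA.inf' ?_ (hr3 (i x) x ⟨hx, rfl⟩))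
      · rintro y ⟨hy, hxy, h | ⟨h, h'⟩⟩
        · exact Or.inl ⟨hy, hxy, h⟩
        · exact Or.inr ⟨⟨hy, h⟩, hxy, h'⟩
      · refine card_le_succ_of_chain hA.inf i fun y hy ↦ ?_
        refine (mk_le_mk_of_subset ?_).trans (thin_of_notMem_cl hA ((hi x hx).2 _ hy.2.2))
        exact fun z hz ↦ ⟨hz.1.2.1, hmono hz.2 (hi z hz.1.1).1⟩

/-- A well-founded orientation of the edges with at most `κ⁺` edges out of each vertex. -/
structure Orientation (X : SimpleGraph V) (κ : Cardinal.{u}) (r : V → V → Prop) : Prop where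
  wf : WellFounded r
  adj : ∀ {x y}, r y x → X.Adj x y
  total : ∀ {x y}, X.Adj x y → r x y ∨ r y x
  card : ∀ x, #{y | r y x} ≤ succ κ

theorem exists_orientation (hA : Ambient κ) (hX : StationaryListColorable X κ) :
    ∃ r, Orientation X κ r := by
  obtain ⟨r, h1, h2, h3⟩ := exists_orientation_on hA hX Set.univ
  refine ⟨fun y x ↦ X.Adj x y ∧ r y x, ⟨fun x ↦ ?_⟩, fun h ↦ h.1, fun {x y} h ↦ ?_, fun x ↦ ?_⟩
  · exact (Subrelation.wf (fun h ↦ h.2) h1).apply x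
  · exact (h2 x trivial y trivial h.ne).imp (⟨h.symm, ·⟩) (⟨h, ·⟩)
  · simpa using h3 x trivial

theorem stationaryListColorable_succ_succ (hA : Ambient κ) (hX : StationaryListColorable X κ) :
    StationaryListColorable X (succ (succ κ)) := by
  obtain ⟨r, hr⟩ := exists_orientation hA hX
  intro L hL
  have hro : RegularOrder (succ (succ κ)) (succ (succ κ)).ord.ToType :=
    regularOrder_toType (isRegular_succ hA.inf') (hA.unc'.trans (lt_succ _))
  obtain ⟨c, hc⟩ := exists_greedy hr.wf L fun x ↦ by
    rw [hro.card_of_stationary (hL x)]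
    exact (hr.card x).trans_lt (lt_succ _)
  refine ⟨SimpleGraph.Coloring.mk c fun {x y} h ↦ ?_, fun v ↦ (hc v).1⟩
  rcases hr.total h with h | h
  · exact (hc y).2 x h
  · exact ((hc x).2 y h).symm

end

/-! ### Small families catching the initial parts of rich neighbourhoods. -/

section
variable {κ lam : Cardinal.{u}} {V : Type u}

theorem exists_card_le_of_iUnion {β : Type u} {c : Cardinal.{u}} (hc : ℵ₀ ≤ c) {ι : Type u}
    (hι : #ι ≤ c) {s : Set β} {f : ι → Set β} (hs : succ c ≤ #s) (hf : s ⊆ ⋃ i, f i) :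
    ∃ i, succ c ≤ #(f i) := by
  by_contra! h
  exact (lt_succ c).not_ge (hs.trans ((mk_le_mk_of_subset hf).trans
    (card_iUnion_le hc hι fun i ↦ lt_succ_iff.1 (h i))))

/-- If a power of a smaller cardinal reaches `lam`, then `lam` is the successor of a cardinal of
small cofinality. -/
theorem exists_eq_succ_of_le_power (hA : Ambient κ) (hK : succ κ < lam) {μ : Cardinal.{u}}
    (hμ : μ < lam) (hμlam : lam ≤ μ ^ κ) :
    κ < μ ∧ lam = succ μ ∧
      ∃ g : κ.ord.ToType → μ.ord.ToType, ∀ b, ∃ i, b < g i := by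
  have hκμ : κ < μ := by
    by_contra! hle
    have : μ ^ κ ≤ succ κ := (power_le_power_right hle).trans
      ((power_self_eq hA.inf).trans_le hA.two_power.le)
    exact (hμlam.trans this).not_gt hK
  have hinf := hA.inf.trans hκμ.le
  have h1 : μ ^ κ ≤ succ μ :=
    (power_le_power_left (aleph0_pos.trans_le hinf).ne' hκμ.le).trans
      ((power_self_eq hinf).trans_le (hA.gch μ hinf).le)
  refine ⟨hκμ, le_antisymm (hμlam.trans h1) (succ_le_of_lt hμ), ?_⟩
  by_contra! hcon
  refine hμ.not_ge (hμlam.trans ?_)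
  have h2 : (Set.univ : Set (κ.ord.ToType → μ.ord.ToType)) ⊆
      ⋃ b : μ.ord.ToType, range fun (f : κ.ord.ToType → Iic b) i ↦ (f i : μ.ord.ToType) := by
    intro g _
    obtain ⟨b, hb⟩ := hcon g
    exact mem_iUnion.2 ⟨b, fun i ↦ ⟨g i, hb i⟩, rfl⟩
  have h3 := (mk_le_mk_of_subset h2).trans (card_iUnion_le hinf (mk_ord_toType μ).le fun b ↦ ?_)
  · rwa [mk_univ, ← power_def, mk_ord_toType, mk_ord_toType] at h3
  · refine mk_range_le.trans ?_
    rw [← power_def, mk_ord_toType]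
    have hb : #(Iic b) < μ := by
      rw [← Iio_insert]
      exact mk_insert_le.trans_lt (add_lt_of_lt hinf
        ((mk_Iio_lt b (by simp)).trans_eq (mk_ord_toType μ)) (one_lt_aleph0.trans_le hinf))
    have hm : max #(Iic b) κ < μ := max_lt hb hκμ
    have hmi : ℵ₀ ≤ max #(Iic b) κ := hA.inf.trans (le_max_right _ _)
    calc #(Iic b) ^ κ ≤ max #(Iic b) κ ^ max #(Iic b) κ :=
          (power_le_power_right (le_max_left _ _)).trans
            (power_le_power_left (aleph0_pos.trans_le hmi).ne' (le_max_right _ _))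
      _ = succ (max #(Iic b) κ) := by rw [power_self_eq hmi, hA.gch _ hmi]
      _ ≤ μ := succ_le_of_lt hm

theorem card_inter_Iio_lt {α : Type u} [LinearOrder α] [WellFoundedLT α] {c : Set α} {γ : α}
    (hcof : ∀ δ < γ, ∃ ε ∈ c, δ ≤ ε)
    (htype : Ordinal.type (fun x y : c ↦ x < y) = (Order.cof (Iio γ)).ord) {ε : α} (hε : ε < γ) :
    #(c ∩ Iio ε : Set α) < Order.cof (Iio γ) := by
  obtain ⟨e, hec, hεe⟩ := hcof ε hε
  have h1 : #c = Order.cof (Iio γ) := by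
    have := congrArg Ordinal.card htype
    simpa using this
  have h2 := mk_Iio_lt (⟨e, hec⟩ : c) (by rw [h1]; exact htype.symm)
  rw [← h1]
  refine lt_of_le_of_lt ?_ h2
  refine mk_le_of_injective (f := fun a ↦ ⟨⟨a.1, a.2.1⟩, lt_of_lt_of_le a.2.2 hεe⟩) ?_
  intro a b hab
  simpa [Subtype.ext_iff] using hab

/-- Approachability provides small families of sets of vertices that contain all initial parts of
a large part of each set of order type `κ⁺`. -/
theorem exists_traces (hA : Ambient κ) (hAP : ApproachabilityAssumption.{u}) (hlam : lam.IsRegular)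
    (hK : succ κ < lam) (ρ : V → lam.ord.ToType) (Y : Set V)
    (hsmall : ∀ δ, #{y ∈ Y | ρ y < δ} < lam) (G : V → T κ) :
    ∃ (F : lam.ord.ToType → Set (Set V)) (C : Set lam.ord.ToType), (∀ η, #(F η) < lam) ∧ IsClub C ∧
      ∀ δ ∈ C, ∀ N ⊆ {y ∈ Y | ρ y < δ}, (∀ ε < δ, #{y ∈ N | ρ y < ε} ≤ κ) → succ κ ≤ #(G '' N) →
        ∃ M ⊆ N, succ κ ≤ #(G '' M) ∧ ∀ ε < δ, ∃ η < δ, {y ∈ M | ρ y < ε} ∈ F η := by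
  classical
  have hro := regularOrder_toType hlam (hA.unc'.trans hK)
  have hinf := hlam.1
  by_cases hcase : ∀ μ < lam, μ ^ κ < lam
  · refine ⟨fun η ↦ {P | P ⊆ {y ∈ Y | ρ y < η} ∧ #P ≤ κ}, Set.univ, fun η ↦ ?_, .univ,
      fun δ _ N hN hthin hG ↦ ⟨N, subset_rfl, hG, fun ε hε ↦ ⟨ε, hε, ?_, hthin ε hε⟩⟩⟩
    · refine (mk_bounded_subset_le _ _).trans_lt (hcase _ (max_lt (hsmall η) ?_))
      exact hA.unc'.trans hK
    · exact fun y hy ↦ ⟨(hN hy.1).1, hy.2⟩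
  · push Not at hcase
    obtain ⟨μ, hμ, hμlam⟩ := hcase
    obtain ⟨hκμ, rfl, g, hg⟩ := exists_eq_succ_of_le_power hA hK hμ hμlam
    have hinfμ := hA.inf.trans hκμ.le
    have hj : ∀ β, ∃ j : V → μ.ord.ToType, InjOn j {y ∈ Y | ρ y < β} := by
      intro β
      have : #{y ∈ Y | ρ y < β} ≤ #μ.ord.ToType := by
        rw [mk_ord_toType]; exact lt_succ_iff.1 (hsmall β)
      obtain ⟨e⟩ := this
      have : Nonempty μ.ord.ToType := by
        rw [← mk_ne_zero_iff, mk_ord_toType]; exact (aleph0_pos.trans_le hinfμ).ne'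
      refine ⟨fun v ↦ if h : v ∈ {y ∈ Y | ρ y < β} then e ⟨v, h⟩ else Classical.arbitrary _, ?_⟩
      intro a ha b hb hab
      simp only [ha, hb, dite_true, e.injective.eq_iff] at hab
      exact congrArg Subtype.val hab
    choose j hj using hj
    -- Since `g` is unbounded in `μ`, each initial segment of `Y` is a union of `κ` pieces `B β i`
    -- of size below `μ`. By GCH, unions of at most `κ` pieces with the same `i` have at most `μ`
    -- subsets.
    let B : (succ μ).ord.ToType → κ.ord.ToType → Set V := fun β i ↦
      {y | (y ∈ Y ∧ ρ y < β) ∧ j β y < g i}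
    have hB : ∀ β i, #(B β i) ≤ #(Iio (g i)) := by
      intro β i
      refine mk_le_of_injective (f := fun a ↦ ⟨j β a.1, a.2.2⟩) ?_
      rintro ⟨a, ha⟩ ⟨b, hb⟩ hab
      exact Subtype.ext (hj β ha.1 hb.1 (congrArg Subtype.val hab))
    have hgi : ∀ i, #(Iio (g i)) < μ := fun i ↦
      (mk_Iio_lt _ (by simp)).trans_eq (mk_ord_toType μ)
    obtain ⟨b, C, -, hC, hap⟩ := hAP _ hlam
    refine ⟨fun η ↦ {P | #(b η) ≤ κ ∧ ∃ i, P ⊆ ⋃ γ ∈ b η, B γ i},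
      C ∩ {d | ∀ a < d, ∃ b, a < b ∧ b < d}, fun η ↦ ?_, hro.isClub_inter hC hro.isClub_limit, ?_⟩
    · refine lt_succ_of_le ?_
      by_cases hbη : #(b η) ≤ κ
      · refine (mk_le_mk_of_subset (t := ⋃ i, 𝒫 (⋃ γ ∈ b η, B γ i)) ?_).trans
          (card_iUnion_le hinfμ ((mk_ord_toType κ).trans_le hκμ.le) fun i ↦ ?_)
        · rintro P ⟨-, i, hP⟩
          exact mem_iUnion.2 ⟨i, hP⟩
        · rw [mk_powerset]
          have hmi : ℵ₀ ≤ max #(Iio (g i)) κ := hA.inf.trans (le_max_right _ _)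
          calc (2 : Cardinal.{u}) ^ #(⋃ γ ∈ b η, B γ i : Set V)
              ≤ 2 ^ max #(Iio (g i)) κ := power_le_power_left two_ne_zero
                (card_biUnion_le hmi (hbη.trans (le_max_right _ _))
                  fun γ _ ↦ (hB γ i).trans (le_max_left _ _))
            _ = succ (max #(Iio (g i)) κ) := hA.gch _ hmi
            _ ≤ μ := succ_le_of_lt (max_lt (hgi i) hκμ)
      · simp [hbη]
    · rintro δ ⟨hδC, hδlim⟩ N hN hthin hGN
      obtain ⟨c, hcδ, hccof, hctype, hcb⟩ := hap δ ⟨hδC, trivial⟩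
      have hcofK : Order.cof (Iio δ) ≤ succ κ := by
        obtain ⟨N', hN', hN'c⟩ := le_mk_iff_exists_subset.1 (hGN.trans mk_image_le)
        let f : N' → Iio δ := fun y ↦ ⟨ρ y, (hN (hN' y.2)).2⟩
        refine (cof_le (s := range f) ?_).trans (mk_range_le.trans hN'c.le)
        by_contra hnc
        obtain ⟨e, he⟩ := not_isCofinal_iff.1 hnc
        refine (lt_succ κ).not_ge (hN'c.ge.trans ((mk_le_mk_of_subset ?_).trans (hthin e e.2)))
        exact fun y hy ↦ ⟨hN' hy, he _ ⟨⟨y, hy⟩, rfl⟩⟩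
      have hcκ : ∀ ε < δ, #(c ∩ Iio ε : Set _) ≤ κ := fun ε hε ↦
        lt_succ_iff.1 ((card_inter_Iio_lt hccof hctype hε).trans_le hcofK)
      have hγ : ∀ y, ∃ γ, y ∈ N → (γ ∈ c ∧ ρ y < γ) ∧ ∀ γ', γ' ∈ c ∧ ρ y < γ' → γ ≤ γ' := by
        intro y
        by_cases hy : y ∈ N
        · obtain ⟨ε, hε, hεδ⟩ := hδlim _ (hN hy).2
          obtain ⟨e, he, hεe⟩ := hccof ε hεδ
          obtain ⟨γ, h⟩ := exists_least (P := fun γ ↦ γ ∈ c ∧ ρ y < γ) ⟨e, he, hε.trans_le hεe⟩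
          exact ⟨γ, fun _ ↦ h⟩
        · exact ⟨δ, fun h ↦ (hy h).elim⟩
      choose γ hγ using hγ
      -- Each `y ∈ N` is placed in the segment given by the next element `γ y` of the approaching
      -- set `c`. One index `i` serves for `κ⁺` values of `G`, and initial parts of the resulting
      -- set are covered using initial parts of `c`, which are sets `b η` with `η < δ`.
      obtain ⟨i, hi⟩ := exists_card_le_of_iUnion hA.inf (mk_ord_toType κ).le hGN
        (f := fun i ↦ G '' {y ∈ N | y ∈ B (γ y) i}) (by
          rintro _ ⟨y, hy, rfl⟩
          obtain ⟨i, hi⟩ := hg (j (γ y) y)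
          exact mem_iUnion.2 ⟨i, y, ⟨hy, ⟨(hN hy).1, (hγ y hy).1.2⟩, hi⟩, rfl⟩)
      refine ⟨{y ∈ N | y ∈ B (γ y) i}, sep_subset _ _, hi, fun ε hε ↦ ?_⟩
      obtain ⟨e, he, hεe⟩ := hccof ε hε
      obtain ⟨ε', heε', hε'⟩ := hδlim e (hcδ he)
      obtain ⟨η, hη, hbη⟩ := hcb ε' hε'
      refine ⟨η, hη, hbη ▸ hcκ ε' hε', i, ?_⟩
      rintro y ⟨⟨hyN, hyB⟩, hyε⟩
      refine mem_biUnion (x := γ y) ?_ hyB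
      rw [← hbη]
      exact ⟨(hγ y hyN).1.1, ((hγ y hyN).2 e ⟨he, hyε.trans_le hεe⟩).trans_lt heε'⟩

end

/-! ### The main use of colorability: thinness on a club. -/

section
variable {κ lam : Cardinal.{u}} {V : Type u} {X : SimpleGraph V}

/-- A coloring cannot exist for a suitable list assignment if stationarily many initial segments
are adjacent in a rich way to later vertices. -/
theorem star_core (hA : Ambient κ) (hX : StationaryListColorable X κ)
    (hlam : lam.IsRegular) (hK : succ κ < lam) (ρ : V → lam.ord.ToType) (G : V → T κ)
    {S : Set lam.ord.ToType} (hS : IsStationary S) (hSlim : ∀ δ ∈ S, ∀ a < δ, ∃ b, a < b ∧ b < δ)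
    (x : lam.ord.ToType → V) (hx : InjOn x S) (M : lam.ord.ToType → Set V)
    (hM : ∀ δ ∈ S, ∀ y ∈ M δ, X.Adj (x δ) y ∧ ρ y < δ)
    (hthin : ∀ δ ∈ S, ∀ ε < δ, #{y ∈ M δ | ρ y < ε} ≤ κ)
    (hG : ∀ δ ∈ S, succ κ ≤ #(G '' M δ))
    (F : lam.ord.ToType → Set (Set V)) (hF : ∀ η, #(F η) < lam)
    (htr : ∀ δ ∈ S, ∀ ε < δ, ∃ η < δ, {y ∈ M δ | ρ y < ε} ∈ F η) : False := by
  classical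
  have hro := regularOrder_toType hlam (hA.unc'.trans hK)
  have hinf := hlam.1
  -- The additional bit separates two roles: a vertex `x δ` may also occur in another `M δ'`. After
  -- all `x δ` are given the same bit `s`, the prescribed clubs are put only on vertices of the
  -- other bit.
  obtain ⟨Φ, hΦ⟩ := exists_sierpinski hA (I := κ.ord.ToType) (W := Clubs κ × Bool)
    (mk_ord_toType κ) (by
      rw [mk_prod]
      simp only [lift_uzero]
      refine (mul_le_mul' ((mk_subtype_le _).trans hA.card_set.le) (?_ : _ ≤ succ κ)).trans
        (mul_eq_self hA.inf').le
      simpa using (natCast_lt_aleph0 (n := 2)).le.trans hA.inf')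
  obtain ⟨i, hi⟩ := hro.stationary_pigeonhole hS (ι := κ.ord.ToType)
    ((mk_ord_toType κ).trans_lt ((lt_succ κ).trans hK))
    (P := fun i δ ↦ ∀ w, ∃ t ∈ G '' M δ, Φ i t = w) fun δ hδ ↦ hΦ _ (hG δ hδ)
  obtain ⟨⟨s⟩, hs⟩ := hro.stationary_pigeonhole hi (ι := ULift.{u} Bool)
    (by simpa using (natCast_lt_aleph0 (n := 2)).trans_le hinf)
    (P := fun s δ ↦ (Φ i (G (x δ))).2 = s.down) fun δ hδ ↦ ⟨⟨_⟩, rfl⟩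
  set S' := {δ ∈ {δ ∈ S | ∀ w, ∃ t ∈ G '' M δ, Φ i t = w} | (Φ i (G (x δ))).2 = s} with hS'
  have hS'S : S' ⊆ S := fun δ hδ ↦ hδ.1.1
  -- All possible predictions: a listed set `P` contained in `lam` many `M δ`, with a stationary set
  -- of colors. There are at most `lam` of them, so each gets its own vertex `x (d j)` with `P ⊆ M
  -- (d j)`, whose list is the predicted color set.
  let J := {j : (Σ η, F η) × Set κ.ord.ToType |
    lam ≤ #{δ ∈ S' | j.1.2.1 ⊆ M δ} ∧ IsStationary j.2}
  have hJ : #J ≤ #lam.ord.ToType := by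
    refine (mk_subtype_le _).trans ?_
    rw [mk_prod, mk_sigma, hA.card_set, mk_ord_toType]
    simp only [lift_id]
    refine (mul_le_mul' (sum_le_mk_mul_iSup _) hK.le).trans ?_
    rw [mk_ord_toType]
    exact (mul_le_mul' ((mul_le_mul' le_rfl (ciSup_le' fun η ↦ (hF η).le)).trans
      (mul_eq_self hinf).le) le_rfl).trans (mul_eq_self hinf).le
  obtain ⟨e⟩ := hJ
  obtain ⟨d, hd⟩ := exists_greedy (r := fun a b : J ↦ e a < e b) (InvImage.wf e wellFounded_lt)
    (fun j ↦ {δ ∈ S' | j.1.1.2.1 ⊆ M δ}) fun j ↦ by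
      refine lt_of_lt_of_le (lt_of_le_of_lt ?_ (hro.card_Iio (e j))) j.2.1
      refine mk_le_of_injective (f := fun a ↦ ⟨e a.1, a.2⟩) fun a b hab ↦ ?_
      exact Subtype.ext (e.injective (congrArg Subtype.val hab))
  have hdinj : ∀ j k, x (d j) = x (d k) → j = k := by
    intro j k hjk
    have := hx (hS'S (hd j).1.1) (hS'S (hd k).1.1) hjk
    by_contra hne
    rcases lt_or_gt_of_ne (fun h ↦ hne (e.injective h)) with h | h
    · exact (hd k).2 j h this
    · exact (hd j).2 k h this.symm
  let L : V → Set κ.ord.ToType := fun v ↦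
    if hv : ∃ j : J, x (d j) = v then hv.choose.1.2
    else if (Φ i (G v)).2 ≠ s then (Φ i (G v)).1 else Set.univ
  have hLd : ∀ j, L (x (d j)) = j.1.2 := by
    intro j
    have hv : ∃ k : J, x (d k) = x (d j) := ⟨j, rfl⟩
    simp only [L, hv, dite_true]
    rw [hdinj _ _ hv.choose_spec]
  have hL1 : ∀ y, (Φ i (G y)).2 ≠ s → L y = (Φ i (G y)).1 := by
    intro y hy
    have hv : ¬ ∃ j : J, x (d j) = y := by
      rintro ⟨j, rfl⟩
      exact hy (hd j).1.1.2
    simp only [L, hv, dite_false, hy, ne_eq, not_false_eq_true, if_true]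
  have := hA.roκ.nonempty
  have hL : ∀ v, IsStationary (L v) := by
    intro v
    by_cases hv : ∃ j : J, x (d j) = v
    · obtain ⟨j, rfl⟩ := hv
      rw [hLd]; exact j.2.2
    · by_cases hv' : (Φ i (G v)).2 ≠ s
      · rw [hL1 v hv']; exact hA.roκ.club_stationary (Φ i (G v)).1.2
      · simp only [L, hv, hv', dite_false, if_false]
        exact .univ
  obtain ⟨c, hc⟩ := hX L hL
  have hstat : ∀ δ ∈ S', IsStationary (c '' {y ∈ M δ | (Φ i (G y)).2 ≠ s}) := by
    intro δ hδ C hC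
    obtain ⟨_, ⟨y, hy, rfl⟩, hyw⟩ := hδ.1.2 (⟨C, hC⟩, !s)
    have hys : (Φ i (G y)).2 ≠ s := by rw [hyw]; simp
    refine ⟨c y, ⟨y, ⟨hy, hys⟩, rfl⟩, ?_⟩
    have := hc y
    rwa [hL1 y hys, hyw] at this
  have hkey : ∀ δ ∈ S', ∃ η < δ, ∃ P ∈ F η, P ⊆ M δ ∧
      IsStationary (c '' {y ∈ P | (Φ i (G y)).2 ≠ s}) := by
    intro δ hδ
    have hchoice : ∀ t, ∃ y, t ∈ c '' {y ∈ M δ | (Φ i (G y)).2 ≠ s} →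
        y ∈ M δ ∧ (Φ i (G y)).2 ≠ s ∧ c y = t := by
      intro t
      by_cases ht : t ∈ c '' {y ∈ M δ | (Φ i (G y)).2 ≠ s}
      · obtain ⟨y, hy, rfl⟩ := ht
        exact ⟨y, fun _ ↦ ⟨hy.1, hy.2, rfl⟩⟩
      · exact ⟨x δ, fun h ↦ (ht h).elim⟩
    choose p hp using hchoice
    -- Only `κ` colors exist, so one witness per color suffices. If these witnesses were cofinal
    -- below `δ`, then `M δ` would be a union of `κ` initial parts of size at most `κ`.
    obtain ⟨ε, hε, hpε⟩ : ∃ ε < δ, ∀ t ∈ c '' {y ∈ M δ | (Φ i (G y)).2 ≠ s}, ρ (p t) < ε := by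
      by_contra! hcon
      refine (lt_succ κ).not_ge ((hG δ (hS'S hδ)).trans (mk_image_le.trans
        ((mk_le_mk_of_subset (t := ⋃ t : κ.ord.ToType,
          {z ∈ M δ | p t ∈ M δ ∧ ρ z ≤ ρ (p t)}) ?_).trans
          (card_iUnion_le hA.inf (mk_ord_toType κ).le fun t ↦ ?_))))
      · intro z hz
        obtain ⟨t, ht, hzt⟩ := hcon (ρ z) (hM δ (hS'S hδ) z hz).2
        exact mem_iUnion.2 ⟨t, hz, (hp t ht).1, hzt⟩
      · by_cases hpt : p t ∈ M δ
        · obtain ⟨b, hb, hbδ⟩ := hSlim δ (hS'S hδ) _ (hM δ (hS'S hδ) _ hpt).2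
          refine (mk_le_mk_of_subset ?_).trans (hthin δ (hS'S hδ) b hbδ)
          exact fun z hz ↦ ⟨hz.1, hz.2.2.trans_lt hb⟩
        · simp [hpt]
    obtain ⟨η, hη, hPη⟩ := htr δ (hS'S hδ) ε hε
    refine ⟨η, hη, _, hPη, sep_subset _ _, (hstat δ hδ).mono ?_⟩
    intro t ht
    obtain ⟨h1, h2, h3⟩ := hp t ht
    exact ⟨p t, ⟨⟨h1, hpε t ht⟩, h2⟩, h3⟩
  obtain ⟨η, hη⟩ := hro.fodor hs hkey
  obtain ⟨⟨P, hPF⟩, hP⟩ := hro.stationary_pigeonhole hη (ι := F η) (hF η)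
    (P := fun P δ ↦ P.1 ⊆ M δ ∧ IsStationary (c '' {y ∈ P.1 | (Φ i (G y)).2 ≠ s}))
    fun δ hδ ↦ by
      obtain ⟨P, h1, h2⟩ := hδ.2
      exact ⟨⟨P, h1⟩, h2⟩
  obtain ⟨δ₀, hδ₀⟩ := hP.nonempty
  -- Fodor and pigeonhole have fixed one `P` for stationarily many `δ`. The actual colors on its
  -- vertices of bit different from `s` form one of the predictions, and the vertex attached to it
  -- cannot be colored.
  let j : J := ⟨(⟨η, P, hPF⟩, c '' {y ∈ P | (Φ i (G y)).2 ≠ s}), by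
    refine (hro.card_of_stationary hP).ge.trans (mk_le_mk_of_subset ?_)
    exact fun δ hδ ↦ ⟨hδ.1.1, hδ.2.1⟩, hδ₀.2.2⟩
  have hfin := hc (x (d j))
  rw [hLd] at hfin
  obtain ⟨y, hy, hcy⟩ := hfin
  exact c.valid (hM _ (hS'S (hd j).1.1) y ((hd j).1.2 hy.1)).1 hcy.symm

/-- On a club of initial segments, no later vertex has many `G`-values among its neighbours in the
segment. -/
theorem exists_club_thin (hA : Ambient κ) (hX : StationaryListColorable X κ)
    (hAP : ApproachabilityAssumption.{u}) (hlam : lam.IsRegular)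
    (hK : succ κ < lam) (ρ : V → lam.ord.ToType) (Y : Set V)
    (hsmall : ∀ δ, #{y ∈ Y | ρ y < δ} < lam) (G : V → T κ) :
    ∃ D : Set lam.ord.ToType, IsClub D ∧ ∀ δ ∈ D, ∀ x ∈ Y, δ ≤ ρ x →
      #(G '' {y ∈ Y | X.Adj x y ∧ ρ y < δ}) ≤ κ := by
  classical
  have hro := regularOrder_toType hlam (hA.unc'.trans hK)
  set S := {δ | ∃ x ∈ Y, δ ≤ ρ x ∧ succ κ ≤ #(G '' {y ∈ Y | X.Adj x y ∧ ρ y < δ})} with hSdef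
  by_cases hS : IsStationary S
  swap
  · obtain ⟨D, hD, hdisj⟩ := not_isStationary_iff.1 hS
    refine ⟨D, hD, fun δ hδ x hx hδx ↦ ?_⟩
    by_contra! h
    exact disjoint_left.1 hdisj ⟨x, hx, hδx, succ_le_of_lt h⟩ hδ
  exfalso
  have hV : ∃ v : V, True := by
    obtain ⟨δ, x, _⟩ := hS.nonempty
    exact ⟨x, trivial⟩
  have hex : ∀ δ, ∃ x, δ ∈ S → x ∈ Y ∧ δ ≤ ρ x ∧
      succ κ ≤ #(G '' {y ∈ Y | X.Adj x y ∧ ρ y < δ}) := by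
    intro δ
    by_cases h : δ ∈ S
    · obtain ⟨x, hx⟩ := h
      exact ⟨x, fun _ ↦ hx⟩
    · exact ⟨hV.choose, fun h' ↦ (h h').elim⟩
  choose x hx using hex
  have hC := hro.isClub_inter hro.isClub_limit (hro.isClub_closed fun δ ↦ ρ (x δ))
  have hinj : InjOn x (S ∩ {d | ∀ a < d, ρ (x a) < d}) := by
    intro a ha b hb hab
    by_contra hne
    rcases lt_or_gt_of_ne hne with h | h
    · exact (hb.2 a h).not_ge (hab ▸ (hx b hb.1).2.1)
    · exact (ha.2 b h).not_ge (hab ▸ (hx a ha.1).2.1)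
  have hS1 := hro.stationary_inter hS hC
  set Rich := {δ | ∃ ε < δ, succ κ ≤ #(X.neighborSet (x δ) ∩ {y ∈ Y | ρ y < ε} : Set V)}
  -- If `Rich` had stationary trace, Fodor would fix `ε` and give `lam` distinct vertices rich over
  -- a set of size below `lam`, against `card_rich_le`.
  have hS2 : IsStationary ((S ∩ ({d | ∀ a < d, ∃ b, a < b ∧ b < d} ∩
      {d | ∀ a < d, ρ (x a) < d})) \ Rich) := by
    rw [← sdiff_union_inter (S ∩ ({d | ∀ a < d, ∃ b, a < b ∧ b < d} ∩
      {d | ∀ a < d, ρ (x a) < d})) Rich, isStationary_union_iff hro.cof_ne] at hS1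
    refine hS1.resolve_right fun hbad ↦ ?_
    obtain ⟨ε, hε⟩ := hro.fodor hbad
      (P := fun ε δ ↦ succ κ ≤ #(X.neighborSet (x δ) ∩ {y ∈ Y | ρ y < ε} : Set V)) fun δ hδ ↦ hδ.2
    have hcard := hro.card_of_stationary (hro.stationary_inter hε (hro.isClub_Ioi ε))
    refine (card_rich_le hA hX {y ∈ Y | ρ y < ε}).not_gt ((hsmall ε).trans_le ?_)
    refine hcard.ge.trans ((mk_image_eq_of_injOn x _ ?_).ge.trans (mk_le_mk_of_subset ?_))
    · refine hinj.mono fun δ hδ ↦ ?_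
      exact ⟨hδ.1.1.1.1, hδ.1.1.1.2.2⟩
    · rintro _ ⟨δ, ⟨⟨⟨⟨hδS, -⟩, -⟩, hδ⟩, hεδ⟩, rfl⟩
      exact ⟨fun h ↦ h.2.not_ge ((le_of_lt hεδ).trans (hx δ hδS).2.1), hδ⟩
  obtain ⟨F, C, hF, hC', htr⟩ := exists_traces hA hAP hlam hK ρ Y hsmall G
  have hS3 := hro.stationary_inter hS2 hC'
  set S3 := ((S ∩ ({d | ∀ a < d, ∃ b, a < b ∧ b < d} ∩
      {d | ∀ a < d, ρ (x a) < d})) \ Rich) ∩ C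
  have hthin : ∀ δ ∈ S3, ∀ ε < δ, #{y ∈ {y ∈ Y | X.Adj (x δ) y ∧ ρ y < δ} | ρ y < ε} ≤ κ := by
    intro δ hδ ε hε
    by_contra! h
    refine hδ.1.2 ⟨ε, hε, (succ_le_of_lt h).trans (mk_le_mk_of_subset ?_)⟩
    exact fun y hy ↦ ⟨hy.1.2.1, hy.1.1, hy.2⟩
  have hM : ∀ δ, ∃ M, δ ∈ S3 → M ⊆ {y ∈ Y | X.Adj (x δ) y ∧ ρ y < δ} ∧ succ κ ≤ #(G '' M) ∧
      ∀ ε < δ, ∃ η < δ, {y ∈ M | ρ y < ε} ∈ F η := by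
    intro δ
    by_cases hδ : δ ∈ S3
    · obtain ⟨M, hM⟩ := htr δ hδ.2 {y ∈ Y | X.Adj (x δ) y ∧ ρ y < δ}
        (fun y hy ↦ ⟨hy.1, hy.2.2⟩) (hthin δ hδ) (hx δ hδ.1.1.1).2.2
      exact ⟨M, fun _ ↦ hM⟩
    · exact ⟨∅, fun h ↦ (hδ h).elim⟩
  choose M hM using hM
  have hinj' : InjOn x S3 := by
    refine hinj.mono fun δ hδ ↦ ?_
    exact ⟨hδ.1.1.1, hδ.1.1.2.2⟩
  refine star_core hA hX hlam hK ρ G hS3 (fun δ hδ ↦ hδ.1.1.2.1) x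
    hinj' M (fun δ hδ y hy ↦ ((hM δ hδ).1 hy).2)
    (fun δ hδ ε hε ↦ (mk_le_mk_of_subset fun y hy ↦ ?_).trans (hthin δ hδ ε hε))
    (fun δ hδ ↦ (hM δ hδ).2.1) F hF (fun δ hδ ↦ (hM δ hδ).2.2)
  exact ⟨(hM δ hδ).1 hy.1, hy.2⟩

end

/-! ### Partitions with small classes, by induction on cardinality. -/

section
variable {κ lam : Cardinal.{u}} {V : Type u} {X : SimpleGraph V} {r : V → V → Prop}

/-- An equivalence relation on `Y` with small classes, coarser than `R₀`, such that the part of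
the lower neighbourhood of a vertex outside its class has few `G`-values. -/
def ThinPartition (κ : Cardinal.{u}) (r R₀ : V → V → Prop) (G : T κ → V → T κ) (Y : Set V) : Prop :=
  ∃ R : V → V → Prop, Equivalence R ∧ (∀ x ∈ Y, ∀ y ∈ Y, R₀ x y → R x y) ∧
    (∀ x ∈ Y, #{y ∈ Y | R x y} ≤ succ κ) ∧
    ∀ x ∈ Y, ∀ t, #(G t '' {y ∈ Y | r y x ∧ ¬ R x y}) ≤ κ

theorem thinPartition_of_card_le {R₀ : V → V → Prop} {G : T κ → V → T κ} {Y : Set V}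
    (hY : #Y ≤ succ κ) : ThinPartition κ r R₀ G Y := by
  refine ⟨fun _ _ ↦ True, ⟨fun _ ↦ trivial, fun _ ↦ trivial, fun _ _ ↦ trivial⟩,
    fun _ _ _ _ _ ↦ trivial, fun x hx ↦ ?_, fun x hx t ↦ ?_⟩
  · simpa using hY
  · simp

/-- Blocks must respect `R₀`, so that refining them separately keeps the partition coarser than
`R₀`. Lower neighbours outside the class of `x` split into those outside its block and those
separated from it inside the block. -/
theorem thinPartition_glue (hA : Ambient κ) {R₀ : V → V → Prop} {G : T κ → V → T κ} {Y : Set V}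
    {ι : Type*} (blk : V → ι) (h1 : ∀ j, ThinPartition κ r R₀ G {y ∈ Y | blk y = j})
    (h2 : ∀ x ∈ Y, ∀ y ∈ Y, R₀ x y → blk x = blk y)
    (h3 : ∀ x ∈ Y, ∀ t, #(G t '' {y ∈ Y | r y x ∧ blk y ≠ blk x}) ≤ κ) :
    ThinPartition κ r R₀ G Y := by
  choose R hR1 hR2 hR3 hR4 using h1
  refine ⟨fun x y ↦ blk x = blk y ∧ R (blk x) x y,
    ⟨fun x ↦ ⟨rfl, (hR1 _).refl x⟩, fun {x y} h ↦ ⟨h.1.symm, h.1 ▸ (hR1 _).symm h.2⟩,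
      fun {x y z} h h' ↦ ⟨h.1.trans h'.1, (hR1 _).trans h.2 (by rw [h.1]; exact h'.2)⟩⟩,
    fun x hx y hy h ↦ ⟨h2 x hx y hy h, hR2 _ x ⟨hx, rfl⟩ y ⟨hy, (h2 x hx y hy h).symm⟩ h⟩,
    fun x hx ↦ (mk_le_mk_of_subset ?_).trans (hR3 (blk x) x ⟨hx, rfl⟩), fun x hx t ↦
      (mk_le_mk_of_subset ?_).trans (card_union_le hA.inf (h3 x hx t) (hR4 (blk x) x ⟨hx, rfl⟩ t))⟩
  · exact fun y hy ↦ ⟨⟨hy.1, hy.2.1.symm⟩, hy.2.2⟩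
  · rw [← image_union]
    refine image_mono fun y hy ↦ ?_
    by_cases hb : blk y = blk x
    · exact Or.inr ⟨⟨hy.1, hb⟩, hy.2.1, fun h ↦ hy.2.2 ⟨hb.symm, h⟩⟩
    · exact Or.inl ⟨hy.1, hy.2.1, hb⟩

/-- Enumeration of a set of vertices in order type its cardinality. -/
theorem exists_enumeration {Y : Set V} (hY : #Y = lam) (hinf : ℵ₀ ≤ lam) :
    ∃ ρ : V → lam.ord.ToType, InjOn ρ Y := by
  obtain ⟨e⟩ : Nonempty (Y ≃ lam.ord.ToType) := Cardinal.eq.1 (by rw [hY, mk_ord_toType])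
  classical
  have : Nonempty lam.ord.ToType := by
    rw [← mk_ne_zero_iff, mk_ord_toType]; exact (aleph0_pos.trans_le hinf).ne'
  refine ⟨fun v ↦ if h : v ∈ Y then e ⟨v, h⟩ else Classical.arbitrary _, fun a ha b hb hab ↦ ?_⟩
  simp only [ha, hb, dite_true, e.injective.eq_iff] at hab
  exact congrArg Subtype.val hab

theorem card_sep_lt_le {α : Type u} [LinearOrder α] {Y : Set V} {ρ : V → α} (hρ : InjOn ρ Y)
    (δ : α) : #{y ∈ Y | ρ y < δ} ≤ #(Iio δ) := by
  refine mk_le_of_injective (f := fun a ↦ ⟨ρ a.1, a.2.2⟩) ?_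
  rintro ⟨a, ha⟩ ⟨b, hb⟩ hab
  exact Subtype.ext (hρ ha.1 hb.1 (congrArg Subtype.val hab))

theorem isClub_closed_under (hro : RegularOrder lam lam.ord.ToType) {μ : Cardinal.{u}}
    (hμ : μ < lam) {Y : Set V} {ρ : V → lam.ord.ToType}
    (hsmall : ∀ δ, #{y ∈ Y | ρ y < δ} < lam) (op : V → Set V) (hop : ∀ x, #(op x) ≤ μ) :
    IsClub {d | ∀ y ∈ Y, ρ y < d → ∀ z ∈ op y, ρ z < d} := by
  have h : ∀ a, ∃ b, ∀ y ∈ Y, ρ y ≤ a → ∀ z ∈ op y, ρ z < b := by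
    intro a
    obtain ⟨a', ha'⟩ := hro.exists_gt' a
    have hcard : #(⋃ y : {y ∈ Y | ρ y < a'}, op y) < lam :=
      hro.card_iUnion_lt (hsmall a') fun y ↦ (hop y).trans_lt hμ
    obtain ⟨b, hb⟩ := hro.exists_gt ((mk_image_le (f := ρ)).trans_lt hcard)
    exact ⟨b, fun y hy hya z hz ↦ hb _ ⟨z, mem_iUnion.2 ⟨⟨y, hy, hya.trans_lt ha'⟩, hz⟩, rfl⟩⟩
  choose f hf using h
  have hcl := hro.isClub_closed f
  refine RegularOrder.isClub_iff_isLUB.2 ⟨fun t ht _ x hx y hy hyx z hz ↦ ?_, fun a ↦ ?_⟩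
  · obtain ⟨w, hw, hyw⟩ := (lt_isLUB_iff hx).1 hyx
    exact (ht hw y hy hyw z hz).trans_le (hx.1 hw)
  · obtain ⟨b, hb, hab⟩ := hcl.isCofinal a
    exact ⟨b, fun y hy hyb z hz ↦ (hf _ y hy le_rfl z hz).trans (hb _ hyb), hab⟩

/-- An enumeration of `Y` is cut at a club closed under lower neighbours and `R₀`-classes. As `κ⁺ <
lam`, this club can be chosen inside the thinness clubs for all `G t` at once. -/
theorem thinPartition_regular (hA : Ambient κ) (hX : StationaryListColorable X κ)
    (hAP : ApproachabilityAssumption.{u}) (hr : Orientation X κ r)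
    {R₀ : V → V → Prop} (hR₀ : Equivalence R₀) (hR₀c : ∀ x, #{y | R₀ x y} ≤ succ κ)
    (G : T κ → V → T κ) {Y : Set V} (hlam : lam.IsRegular) (hK : succ κ < lam) (hY : #Y = lam)
    (ih : ∀ Z : Set V, #Z < lam → ThinPartition κ r R₀ G Z) : ThinPartition κ r R₀ G Y := by
  have hro := regularOrder_toType hlam (hA.unc'.trans hK)
  obtain ⟨ρ, hρ⟩ := exists_enumeration hY hlam.1
  have hsmall : ∀ δ, #{y ∈ Y | ρ y < δ} < lam := fun δ ↦
    (card_sep_lt_le hρ δ).trans_lt (hro.card_Iio δ)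
  choose D' hD' hthin using fun t ↦ exists_club_thin hA hX hAP hlam hK ρ Y hsmall (G t)
  set D := (⋂ t, D' t) ∩ {d | ∀ y ∈ Y, ρ y < d → ∀ z ∈ {z | r z y} ∪ {z | R₀ y z}, ρ z < d}
    with hDdef
  have hD : IsClub D := hro.isClub_inter (hro.isClub_iInter (by rwa [hA.roT.card_eq]) hD')
    (isClub_closed_under hro hK hsmall _ fun x ↦ card_union_le hA.inf' (hr.card x) (hR₀c x))
  refine thinPartition_glue hA (fun y ↦ {d ∈ D | d ≤ ρ y}) (fun j ↦ ih _ ?_) ?_ ?_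
  · by_cases hne : ({y ∈ Y | {d ∈ D | d ≤ ρ y} = j}).Nonempty
    · obtain ⟨x, hx, rfl⟩ := hne
      obtain ⟨b, hb⟩ := hro.exists_gt' (ρ x)
      obtain ⟨d, hd, hbd⟩ := hD.isCofinal b
      refine (mk_le_mk_of_subset ?_).trans_lt (hsmall d)
      refine fun y hy ↦ ⟨hy.1, ?_⟩
      by_contra! hdy
      have : d ∈ {d ∈ D | d ≤ ρ x} := hy.2 ▸ ⟨hd, hdy⟩
      exact this.2.not_gt (hb.trans_le hbd)
    · rw [not_nonempty_iff_eq_empty.1 hne]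
      simpa using hlam.pos
  · have key : ∀ x ∈ Y, ∀ y, R₀ x y → {d ∈ D | d ≤ ρ y} ⊆ {d ∈ D | d ≤ ρ x} := by
      rintro x hx y hxy d ⟨hd, hdy⟩
      refine ⟨hd, ?_⟩
      by_contra! h
      exact hdy.not_gt (hd.2 x hx h y (Or.inr hxy))
    exact fun x hx y hy hxy ↦ (key y hy x (hR₀.symm hxy)).antisymm (key x hx y hxy)
  · intro x hx t
    have key : ∀ y, r y x → {d ∈ D | d ≤ ρ y} ≠ {d ∈ D | d ≤ ρ x} →
        ∃ d ∈ D, ρ y < d ∧ d ≤ ρ x := by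
      intro y hyx hne
      by_contra! hcon
      refine hne (subset_antisymm ?_ ?_)
      · rintro d hd
        refine ⟨hd.1, ?_⟩
        by_contra! h
        exact hd.2.not_gt (hd.1.2 x hx h y (Or.inl hyx))
      · rintro d hd
        refine ⟨hd.1, ?_⟩
        by_contra! h
        exact hd.2.not_gt (hcon d hd.1 h)
    by_cases hne : ∃ d ∈ D, d ≤ ρ x
    · obtain ⟨d, hd, hdx⟩ := hne
      -- Lower neighbours in other blocks all lie below the last cut point `m` not above `ρ x`, so
      -- thinness at `m` alone bounds their values.
      obtain ⟨m, hm, hmx, -, hmax⟩ := RegularOrder.club_exists_max hD hd hdx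
      refine (mk_le_mk_of_subset (image_mono ?_)).trans
        (hthin t m (mem_iInter.1 hm.1 t) x hx hmx)
      rintro y ⟨hy, hyx, hb⟩
      obtain ⟨d', hd', hyd', hd'x⟩ := key y hyx hb
      exact ⟨hy, hr.adj hyx, hyd'.trans_le (hmax d' hd' hd'x)⟩
    · have : {y ∈ Y | r y x ∧ {d ∈ D | d ≤ ρ y} ≠ {d ∈ D | d ≤ ρ x}} = ∅ := by
        rw [eq_empty_iff_forall_notMem]
        rintro y ⟨-, hyx, hb⟩
        obtain ⟨d', hd', -, hd'x⟩ := key y hyx hb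
        exact hne ⟨d', hd', hd'x⟩
      simp [this]

/-- A club of small cardinality in a well-order. -/
theorem exists_small_club {α : Type u} [LinearOrder α] [WellFoundedLT α] [NoMaxOrder α]
    [Nonempty α] (a₀ : α) : ∃ c : Set α, IsClub c ∧ #c ≤ Order.cof α ∧ ∀ a ∈ c, a₀ ≤ a := by
  obtain ⟨s, hs, hsc⟩ := exists_cof_eq (α := α)
  refine ⟨{x | a₀ ≤ x ∧ (x ∈ s ∨ ∀ a < x, ∃ b ∈ s, a < b ∧ b < x)},
    RegularOrder.isClub_iff_isLUB.2 ⟨fun t ht h0 x hx ↦ ?_, fun a ↦ ?_⟩, ?_, fun a ha ↦ ha.1⟩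
  · obtain ⟨y, hy⟩ := h0
    refine ⟨(ht hy).1.trans (hx.1 hy), ?_⟩
    by_cases hxt : x ∈ t
    · exact (ht hxt).2
    · refine Or.inr fun a ha ↦ ?_
      obtain ⟨z, hz, haz⟩ := (lt_isLUB_iff hx).1 ha
      have hzx : z < x := lt_of_le_of_ne (hx.1 hz) fun h ↦ hxt (h ▸ hz)
      rcases (ht hz).2 with h | h
      · exact ⟨z, h, haz, hzx⟩
      · obtain ⟨b, hb, hab, hbz⟩ := h a haz
        exact ⟨b, hb, hab, hbz.trans hzx⟩
  · obtain ⟨b, hb, hab⟩ := hs (max a a₀)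
    exact ⟨b, ⟨(le_max_right _ _).trans hab, Or.inl hb⟩, (le_max_left _ _).trans hab⟩
  · have hinf : ℵ₀ ≤ Order.cof α := aleph0_le_cof
    refine (mk_le_mk_of_subset (t := s ∪ {x | ∀ a < x, ∃ b ∈ s, a < b ∧ b < x})
      fun x hx ↦ hx.2).trans (card_union_le hinf hsc.le ?_)
    rw [← hsc]
    -- A limit point is determined by the least element of `s` at or above it: between two limit
    -- points there is an element of `s`.
    choose f hf hxf using hs
    have hf' : ∀ x, ∃ m : s, x ≤ m.1 ∧ ∀ b ∈ s, x ≤ b → m.1 ≤ b := by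
      intro x
      obtain ⟨m, hm, hm'⟩ := exists_least (P := fun b ↦ b ∈ s ∧ x ≤ b) ⟨f x, hf x, hxf x⟩
      exact ⟨⟨m, hm.1⟩, hm.2, fun b hb hxb ↦ hm' b ⟨hb, hxb⟩⟩
    choose g hg hg' using hf'
    refine mk_le_of_injective (f := fun x ↦ g x.1) ?_
    have key : ∀ x y : α, x < y → (∀ a < y, ∃ b ∈ s, a < b ∧ b < y) → g x ≠ g y := by
      intro x y hxy hy heq
      obtain ⟨b, hb, hxb, hby⟩ := hy x hxy
      exact ((hg' x b hb hxb.le).trans_lt hby).not_ge (heq ▸ hg y)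
    rintro ⟨x, hx⟩ ⟨y, hy⟩ hxy
    rcases lt_trichotomy x y with h | h | h
    · exact (key x y h hy hxy).elim
    · exact Subtype.ext h
    · exact (key y x h hx hxy.symm).elim

/-- Here closed sets give at most `κ` neighbours, not just few `G`-values, and approachability is
not needed. The difficulty is to make a filtration of length `cof lam` by small closed sets
continuous; this is done as in singular compactness, by interleaving enumerations of all its
members. -/
theorem thinPartition_singular (hA : Ambient κ) (hX : StationaryListColorable X κ)
    (hr : Orientation X κ r)
    {R₀ : V → V → Prop} (hR₀ : Equivalence R₀) (hR₀c : ∀ x, #{y | R₀ x y} ≤ succ κ)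
    (G : T κ → V → T κ) {Y : Set V} (hlam : lam.IsSingular) (hK : succ κ < lam) (hY : #Y = lam)
    (ih : ∀ Z : Set V, #Z < lam → ThinPartition κ r R₀ G Z) : ThinPartition κ r R₀ G Y := by
  classical
  have hinf := hA.inf'.trans hK.le
  obtain ⟨ρ, hρ⟩ := exists_enumeration hY hinf
  have hIio : ∀ a : lam.ord.ToType, #(Iio a) < lam := fun a ↦
    (mk_Iio_lt a (by simp)).trans_eq (mk_ord_toType lam)
  have : NoMaxOrder lam.ord.ToType := by
    refine ⟨fun a ↦ ?_⟩
    by_contra! hb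
    have h1 : Iic a = Set.univ := eq_univ_of_forall hb
    have h2 : #(Iic a) < lam := by
      rw [← Iio_insert]
      exact mk_insert_le.trans_lt (add_lt_of_lt hinf (hIio a) (one_lt_aleph0.trans_le hinf))
    rw [h1, mk_univ, mk_ord_toType] at h2
    exact h2.ne rfl
  have : Nonempty lam.ord.ToType := by
    rw [← mk_ne_zero_iff, mk_ord_toType]; exact (aleph0_pos.trans_le hinf).ne'
  have hcof : Order.cof lam.ord.ToType < lam := by
    rw [Ordinal.cof_toType]; exact hlam.cof_ord_lt
  set μ := max (succ κ) (Order.cof lam.ord.ToType) with hμ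
  have hμlam : μ < lam := max_lt hK hcof
  have hμinf : ℵ₀ ≤ μ := hA.inf'.trans (le_max_left _ _)
  -- Indices start at `a₀` so that every set in the filtration has room for `κ⁺` operations and `cof
  -- lam` enumerations.
  obtain ⟨a₀, ha₀⟩ : ∃ a : lam.ord.ToType, μ ≤ #(Iio a) := by
    by_contra! hcon
    have h1 := card_le_succ_of_chain hμinf (S := (Set.univ : Set lam.ord.ToType)) id fun y _ ↦ by
      obtain ⟨z, hz⟩ := exists_gt y
      exact (mk_le_mk_of_subset fun w hw ↦ lt_of_le_of_lt hw.2 hz).trans (hcon z).le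
    rw [mk_univ, mk_ord_toType] at h1
    exact (hlam.isSuccLimit.succ_lt hμlam).not_ge h1
  obtain ⟨c, hc, hcμ, hca⟩ := exists_small_club a₀
  have hrk : ∀ (A : Set V) (k : lam.ord.ToType), ∃ f : V → lam.ord.ToType,
      #A ≤ #(Iio k) → InjOn f A ∧ ∀ a ∈ A, f a < k := by
    intro A k
    by_cases h : #A ≤ #(Iio k)
    · obtain ⟨e⟩ := id h
      refine ⟨fun v ↦ if h : v ∈ A then e ⟨v, h⟩ else Classical.arbitrary _, fun _ ↦
        ⟨fun a ha b hb hab ↦ ?_, fun a ha ↦ ?_⟩⟩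
      · simp only [ha, hb, dite_true, Subtype.val_inj, e.injective.eq_iff] at hab
        exact congrArg Subtype.val hab
      · simp only [ha, dite_true]
        exact (e ⟨a, ha⟩).2
    · exact ⟨fun _ ↦ Classical.arbitrary _, fun h' ↦ (h h').elim⟩
  choose rk hrk using hrk
  let op : V → Set V := fun y ↦ {z | r z y} ∪ {z | R₀ y z}
  have hop : ∀ y, #(op y) ≤ succ κ := fun y ↦ card_union_le hA.inf' (hr.card y) (hR₀c y)
  -- Besides closing off, the set at `j` receives the elements of rank below `j` in every set `A k`
  -- with `k ∈ c`. At a limit `j` of `c`, an element of `A n j` has rank below some smaller `b ∈ c`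
  -- and so enters at `b`: this is continuity.
  let step : (lam.ord.ToType → Set V) → lam.ord.ToType → Set V := fun A j ↦
    clStep X κ op (A j) ∪ {y | ∃ k ∈ c, y ∈ A k ∧ rk (A k) k y < j}
  let A : ℕ → lam.ord.ToType → Set V := fun n ↦ step^[n] fun j ↦ {y ∈ Y | ρ y < j}
  have hAs : ∀ n, A (n + 1) = step (A n) := fun n ↦ Function.iterate_succ_apply' step n _
  have hAcard : ∀ n, ∀ j, a₀ ≤ j → #(A n j) ≤ #(Iio j) := by
    intro n
    induction n with
    | zero => exact fun j _ ↦ card_sep_lt_le hρ j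
    | succ n ihn =>
      intro j hj
      have hj' : μ ≤ #(Iio j) := ha₀.trans (mk_le_mk_of_subset (Iio_subset_Iio hj))
      rw [hAs]
      refine card_union_le (hμinf.trans hj') (card_clStep hA hX
        (fun x ↦ (hop x).trans ((le_max_left _ _).trans hj')) (hμinf.trans hj') (ihn j hj)) ?_
      refine (mk_le_mk_of_subset (t := ⋃ k ∈ c, {y ∈ A n k | rk (A n k) k y < j}) ?_).trans
        (card_biUnion_le (hμinf.trans hj') (hcμ.trans ((le_max_right _ _).trans hj'))
          fun k hk ↦ card_sep_lt_le (hrk _ _ (ihn k (hca k hk))).1 j)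
      rintro y ⟨k, hk, h⟩
      exact mem_biUnion hk h
  have hAmono : ∀ n, Monotone (A n) := by
    intro n
    induction n with
    | zero => exact fun i j hij y hy ↦ ⟨hy.1, hy.2.trans_le hij⟩
    | succ n ihn =>
      intro i j hij
      rw [hAs]
      refine union_subset_union (clStep_mono op (ihn hij)) ?_
      rintro y ⟨k, hk, h1, h2⟩
      exact ⟨k, hk, h1, h2.trans_le hij⟩
  let B : lam.ord.ToType → Set V := fun j ↦ ⋃ n, A n j
  have hBmono : Monotone B := fun i j hij ↦ iUnion_mono fun n ↦ hAmono n hij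
  have hBop : ∀ j, ∀ y ∈ B j, op y ⊆ B j := by
    intro j y hy z hz
    obtain ⟨n, hn⟩ := mem_iUnion.1 hy
    refine mem_iUnion.2 ⟨n + 1, ?_⟩
    rw [hAs]
    exact Or.inl (Or.inr (mem_biUnion hn hz))
  have hBcard : ∀ j, a₀ ≤ j → #(B j) < lam := fun j hj ↦
    (card_iUnion_nat_le ((hμinf.trans ha₀).trans (mk_le_mk_of_subset (Iio_subset_Iio hj)))
      fun n ↦ hAcard n j hj).trans_lt (hIio j)
  have hBthin : ∀ j, ∀ v ∉ B j, #(X.neighborSet v ∩ B j : Set V) ≤ κ := fun j v hv ↦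
    thin_of_notMem_iUnion hA (op := op) (A := fun n ↦ A n j)
      (fun n ↦ by rw [hAs]; exact subset_union_left) hv
  have hBcont : ∀ j ∈ c, (∀ a < j, ∃ b ∈ c, a < b ∧ b < j) → ∀ y ∈ B j, ∃ b ∈ c, b < j ∧ y ∈ B b := by
    intro j hj hlim y hy
    obtain ⟨n, hn⟩ := mem_iUnion.1 hy
    obtain ⟨b, hb, h1, h2⟩ := hlim _ ((hrk _ _ (hAcard n j (hca j hj))).2 y hn)
    refine ⟨b, hb, h2, mem_iUnion.2 ⟨n + 1, ?_⟩⟩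
    rw [hAs]
    exact Or.inr ⟨j, hj, hn, h1⟩
  have hBex : ∀ y ∈ Y, ∃ j ∈ c, y ∈ B j := by
    intro y hy
    obtain ⟨b, hb⟩ := exists_gt (ρ y)
    obtain ⟨j, hj, hbj⟩ := hc.isCofinal b
    exact ⟨j, hj, mem_iUnion.2 ⟨0, hy, hb.trans_le hbj⟩⟩
  refine thinPartition_glue hA (fun y ↦ {j ∈ c | y ∈ B j}) (fun J ↦ ih _ ?_) ?_ ?_
  · by_cases hne : ({y ∈ Y | {j ∈ c | y ∈ B j} = J}).Nonempty
    · obtain ⟨x, hx, rfl⟩ := hne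
      obtain ⟨j, hj, hxj⟩ := hBex x hx
      refine (mk_le_mk_of_subset ?_).trans_lt (hBcard j (hca j hj))
      intro y hy
      have : j ∈ {j ∈ c | y ∈ B j} := hy.2 ▸ ⟨hj, hxj⟩
      exact this.2
    · rw [not_nonempty_iff_eq_empty.1 hne]
      simpa using hlam.pos
  · have key : ∀ x y, R₀ x y → {j ∈ c | x ∈ B j} ⊆ {j ∈ c | y ∈ B j} :=
      fun x y hxy j hj ↦ ⟨hj.1, hBop j x hj.2 (Or.inr hxy)⟩
    exact fun x _ y _ hxy ↦ (key x y hxy).antisymm (key y x (hR₀.symm hxy))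
  · intro x hx t
    obtain ⟨j, ⟨hj, hxj⟩, hmin⟩ := exists_least (P := fun j ↦ j ∈ c ∧ x ∈ B j) (hBex x hx)
    have key : ∀ y, r y x → {j ∈ c | y ∈ B j} ≠ {j ∈ c | x ∈ B j} →
        ∃ k ∈ c, k < j ∧ y ∈ B k := by
      intro y hyx hne
      by_contra! hcon
      refine hne (subset_antisymm (fun k hk ↦ ⟨hk.1, ?_⟩) fun k hk ↦
        ⟨hk.1, hBop k x hk.2 (Or.inl hyx)⟩)
      exact hBmono (not_lt.1 fun h ↦ hcon k hk.1 h hk.2) hxj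
    -- By continuity the first index `j` containing `x` is not a limit of `c`. Its predecessor in
    -- `c`, if any, gives a closed set omitting `x` but containing all lower neighbours of `x` in
    -- other blocks.
    obtain ⟨a, haj, ha⟩ : ∃ a < j, ∀ b ∈ c, a < b → j ≤ b := by
      by_contra! hcon
      obtain ⟨b, hb, hbj, hxb⟩ := hBcont j hj hcon x hxj
      exact (hmin b ⟨hb, hxb⟩).not_gt hbj
    by_cases hne : ∃ d ∈ c, d < j
    · obtain ⟨d, hd, hdj⟩ := hne
      have hda : d ≤ a := not_lt.1 fun h ↦ (ha d hd h).not_gt hdj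
      obtain ⟨m, hm, hma, -, hmax⟩ := RegularOrder.club_exists_max hc hd hda
      have hxm : x ∉ B m := fun h ↦ (hmin m ⟨hm, h⟩).not_gt (hma.trans_lt haj)
      refine mk_image_le.trans ((mk_le_mk_of_subset ?_).trans (hBthin m x hxm))
      rintro y ⟨hy, hyx, hb⟩
      obtain ⟨k, hk, hkj, hyk⟩ := key y hyx hb
      exact ⟨hr.adj hyx, hBmono (hmax k hk (not_lt.1 fun h ↦ (ha k hk h).not_gt hkj)) hyk⟩
    · have : {y ∈ Y | r y x ∧ {j ∈ c | y ∈ B j} ≠ {j ∈ c | x ∈ B j}} = ∅ := by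
        rw [eq_empty_iff_forall_notMem]
        rintro y ⟨-, hyx, hb⟩
        obtain ⟨k, hk, hkj, -⟩ := key y hyx hb
        exact hne ⟨k, hk, hkj⟩
      simp [this]

theorem thinPartition (hA : Ambient κ) (hX : StationaryListColorable X κ)
    (hAP : ApproachabilityAssumption.{u}) (hr : Orientation X κ r)
    {R₀ : V → V → Prop} (hR₀ : Equivalence R₀) (hR₀c : ∀ x, #{y | R₀ x y} ≤ succ κ)
    (G : T κ → V → T κ) (Y : Set V) : ThinPartition κ r R₀ G Y := by
  induction hY : #Y using WellFoundedLT.induction generalizing Y with | _ lam ih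
  rcases le_or_gt lam (succ κ) with hle | hK
  · exact thinPartition_of_card_le (hY.trans_le hle)
  · rcases isRegular_or_isSingular (hA.inf'.trans hK.le) with h | h
    · exact thinPartition_regular hA hX hAP hr hR₀ hR₀c G h hK hY fun Z hZ ↦ ih _ hZ Z rfl
    · exact thinPartition_singular hA hX hr hR₀ hR₀c G h hK hY fun Z hZ ↦ ih _ hZ Z rfl

end

/-! ### Ladders and almost disjointness. -/

section
variable {κ : Cardinal.{u}} {V : Type u} {X : SimpleGraph V} {r : V → V → Prop}

/-- An unbounded set of `κ⁺` none of whose elements is a limit of elements of the set. -/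
structure Ladder {α : Type*} [LinearOrder α] (E : Set α) : Prop where
  unbounded : ∀ a, ∃ ξ ∈ E, a < ξ
  discrete : ∀ ξ ∈ E, ∃ s < ξ, ∀ η ∈ E, s < η → ξ ≤ η

/-- The clubs avoiding the nonstationary members of `𝒰` are intersected diagonally. The non-limit
points of the trace of `A` on this club form the ladder: beyond the index of `U` it lies in the club
that avoids `U`. -/
theorem RegularOrder.exists_ladder {μ : Cardinal.{u}} {α : Type u} [LinearOrder α]
    [WellFoundedLT α] (h : RegularOrder μ α) {A : Set α} (hA : IsStationary A)
    {𝒰 : Set (Set α)} (h𝒰 : #𝒰 ≤ μ) : ∃ E ⊆ A, Ladder E ∧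
      ∀ U ∈ 𝒰, ¬ IsStationary U → ∃ b, ∀ ξ ∈ E, ξ ∈ U → ξ ≤ b := by
  classical
  have hC : ∀ U : Set α, ∃ C, IsClub C ∧ (¬ IsStationary U → Disjoint U C) := by
    intro U
    by_cases hU : IsStationary U
    · exact ⟨Set.univ, .univ, fun h ↦ (h hU).elim⟩
    · obtain ⟨C, hC, hd⟩ := not_isStationary_iff.1 hU
      exact ⟨C, hC, fun _ ↦ hd⟩
  choose C hC hdisj using hC
  obtain ⟨e⟩ : Nonempty (𝒰 ↪ α) := by
    have : #𝒰 ≤ #α := by rwa [h.card_eq]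
    exact this
  let C' : α → Set α := fun a ↦ ⋂ U : {U : 𝒰 // e U = a}, C U.1
  have hC' : ∀ a, IsClub (C' a) := by
    intro a
    refine h.isClub_iInter ((mk_le_one_iff_set_subsingleton.2 ?_).trans_lt
      (one_lt_aleph0.trans h.unc)) fun U ↦ hC U.1
    exact fun U hU U' hU' ↦ e.injective (hU.trans hU'.symm)
  have hB := h.stationary_inter hA (h.isClub_diag hC')
  set B := A ∩ {d | ∀ a < d, d ∈ C' a}
  refine ⟨{ξ ∈ B | ∃ s < ξ, ∀ η ∈ B, s < η → ξ ≤ η}, fun ξ hξ ↦ hξ.1.1, ⟨fun a ↦ ?_, ?_⟩, ?_⟩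
  · obtain ⟨ξ, hξ, hmin⟩ := exists_least (P := fun ξ ↦ ξ ∈ B ∧ a < ξ) (h.stationary_exists_gt hB a)
    exact ⟨ξ, ⟨hξ.1, a, hξ.2, fun η h1 h2 ↦ hmin η ⟨h1, h2⟩⟩, hξ.2⟩
  · rintro ξ ⟨hξ, s, hs, hmin⟩
    exact ⟨s, hs, fun η hη ↦ hmin η hη.1⟩
  · intro U hU hns
    refine ⟨e ⟨U, hU⟩, fun ξ hξ hξU ↦ not_lt.1 fun hlt ↦ ?_⟩
    exact disjoint_left.1 (hdisj U hns) hξU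
      (mem_iInter.1 (hξ.1.2 _ hlt) ⟨⟨U, hU⟩, rfl⟩)

open Classical in
/-- The least element of `E` above `t`. -/
noncomputable def next {α : Type*} [LinearOrder α] [WellFoundedLT α] (E : Set α) (t : α) : α :=
  if h : ∃ ξ, ξ ∈ E ∧ t < ξ then (exists_least h).choose else t

theorem next_eq {α : Type*} [LinearOrder α] [WellFoundedLT α] {E : Set α} {t ξ : α} (hξ : ξ ∈ E)
    (ht : t < ξ) (hmin : ∀ η ∈ E, t < η → ξ ≤ η) : next E t = ξ := by
  have h : ∃ ξ, ξ ∈ E ∧ t < ξ := ⟨ξ, hξ, ht⟩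
  rw [next, dif_pos h]
  have h' := (exists_least h).choose_spec
  exact le_antisymm (h'.2 ξ ⟨hξ, ht⟩) (hmin _ h'.1.1 h'.1.2)

/-- By discreteness each `ξ` in a ladder is `next (E y) s` for some `s < ξ`. If the union were
stationary, Fodor would fix `s` and produce `μ` values. -/
theorem RegularOrder.not_isStationary_of_thin {μ : Cardinal.{u}} {α : Type u} [LinearOrder α]
    [WellFoundedLT α] (h : RegularOrder μ α) {E : V → Set α} {N : Set V}
    (hE : ∀ y ∈ N, Ladder (E y)) (hN : ∀ t, #((fun y ↦ next (E y) t) '' N) < μ) :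
    ¬ IsStationary (⋃ y ∈ N, E y) := by
  intro hS
  obtain ⟨s, hs⟩ := h.fodor hS (P := fun s ξ ↦ ∃ y ∈ N, next (E y) s = ξ) fun ξ hξ ↦ by
    obtain ⟨y, hy, hξy⟩ := mem_iUnion₂.1 hξ
    obtain ⟨s, hs, hmin⟩ := (hE y hy).discrete ξ hξy
    exact ⟨s, hs, y, hy, next_eq hξy hs hmin⟩
  refine (hN s).not_ge ((h.card_of_stationary hs).ge.trans (mk_le_mk_of_subset ?_))
  rintro ξ ⟨-, y, hy, rfl⟩
  exact ⟨y, hy, rfl⟩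

/-- Ladders in given stationary sets that, along a well-founded relation, are almost disjoint from
the unions of earlier ladders over the members of `tr x`, if these are nonstationary. -/
theorem exists_ladder_system (hA : Ambient κ) (hr : WellFounded r) {L : V → Set (T κ)}
    (hL : ∀ v, IsStationary (L v)) : ∃ E : (V → Set (Set V)) → V → Set (T κ),
      (∀ tr x, #(tr x) ≤ succ κ → E tr x ⊆ L x ∧ Ladder (E tr x) ∧
        ∀ N ∈ tr x, ¬ IsStationary (⋃ y ∈ {y ∈ N | r y x}, E tr y) →
          ∃ b, ∀ ξ ∈ E tr x, ∀ y ∈ N, r y x → ξ ∈ E tr y → ξ ≤ b) ∧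
      ∀ tr tr' x, tr x = tr' x → (∀ y, r y x → E tr y = E tr' y) → E tr x = E tr' x := by
  have hpsi : ∀ (x : V) (𝒰 : Set (Set (T κ))), ∃ E, #𝒰 ≤ succ κ → E ⊆ L x ∧ Ladder E ∧
      ∀ U ∈ 𝒰, ¬ IsStationary U → ∃ b, ∀ ξ ∈ E, ξ ∈ U → ξ ≤ b := by
    intro x 𝒰
    by_cases h : #𝒰 ≤ succ κ
    · obtain ⟨E, hE⟩ := hA.roT.exists_ladder (hL x) h
      exact ⟨E, fun _ ↦ hE⟩
    · exact ⟨∅, fun h' ↦ (h h').elim⟩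
  choose ψ hψ using hpsi
  have hE : ∀ tr : V → Set (Set V), ∃ E : V → Set (T κ), ∀ x,
      E x = ψ x ((fun N ↦ ⋃ y ∈ {y ∈ N | r y x}, E y) '' tr x) := by
    intro tr
    refine exists_rec hr
      (P := fun x E b ↦ b = ψ x ((fun N ↦ ⋃ y ∈ {y ∈ N | r y x}, E y) '' tr x)) ?_
      fun _ _ ↦ ⟨_, rfl⟩
    rintro x f g b hfg rfl
    congr 1
    refine image_congr fun N _ ↦ iUnion₂_congr fun y hy ↦ hfg y hy.2
  choose E hE using hE
  refine ⟨E, fun tr x htr ↦ ?_, fun tr tr' x h h' ↦ ?_⟩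
  · obtain ⟨h1, h2, h3⟩ := hψ x _ ((mk_image_le
      (f := fun N ↦ ⋃ y ∈ {y ∈ N | r y x}, E tr y)).trans htr)
    rw [← hE] at h1 h2 h3
    refine ⟨h1, h2, fun N hN hns ↦ ?_⟩
    obtain ⟨b, hb⟩ := h3 _ ⟨N, hN, rfl⟩ hns
    exact ⟨b, fun ξ hξ y hy hyx hξy ↦ hb ξ hξ (mem_iUnion₂.2 ⟨y, ⟨hy, hyx⟩, hξy⟩)⟩
  · rw [hE tr, hE tr', h]
    congr 1
    refine image_congr fun N _ ↦ iUnion₂_congr fun y hy ↦ h' y hy.2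

end

/-! ### Iterating partitions and ladders until they stabilize. -/

section
variable {κ : Cardinal.{u}} {V : Type u} {X : SimpleGraph V} {r : V → V → Prop}

/-- The union of the relations before stage `i`, made reflexive. -/
def prevRel {ι : Type*} [LT ι] (R : ι → V → V → Prop) (i : ι) (x y : V) : Prop :=
  x = y ∨ ∃ j < i, R j x y

/-- The part of the lower neighbourhood of `x` outside its class before stage `i`, and the parts in
those earlier stages of the class of the leader of `x` to which `x` does not belong. -/
def traces {ι : Type*} [Preorder ι] (w : V → Cardinal.{u}) (r : V → V → Prop)
    (R : ι → V → V → Prop) (i : ι) (x : V) : Set (Set V) :=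
  {N | N = {y | r y x ∧ ¬ prevRel R i x y} ∨ ∃ z j, prevRel R i x z ∧
    (∀ y, prevRel R i x y → w z ≤ w y) ∧ j ≤ i ∧ ¬ prevRel R j z x ∧
    N = {y | r y x ∧ prevRel R j z y}}

theorem prevRel_congr {ι : Type*} [Preorder ι] {R R' : ι → V → V → Prop} {i : ι}
    (h : ∀ j < i, R j = R' j) : prevRel R i = prevRel R' i := by
  ext x y
  refine or_congr Iff.rfl (exists_congr fun j ↦ and_congr_right fun hj ↦ by rw [h j hj])

theorem traces_congr {ι : Type*} [Preorder ι] {w : V → Cardinal.{u}} {R R' : ι → V → V → Prop}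
    {i : ι} (h : ∀ j < i, R j = R' j) : traces w r R i = traces w r R' i := by
  ext x N
  simp only [traces, prevRel_congr h, mem_ofPred_eq]
  refine or_congr Iff.rfl (exists_congr fun z ↦ exists_congr fun j ↦ and_congr_right fun _ ↦
    and_congr_right fun _ ↦ and_congr_right fun hj ↦ ?_)
  rw [prevRel_congr fun k hk ↦ h k (hk.trans_le hj)]

/-- The leader is unique because `w` is injective, so the traces are indexed by the stages up to
`i`, with one more set. -/
theorem card_traces {ι : Type u} [Preorder ι] {c : Cardinal.{u}} (hc : ℵ₀ ≤ c)
    {w : V → Cardinal.{u}} (hw : Function.Injective w) {R : ι → V → V → Prop} {i : ι}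
    (hi : #(Iic i) ≤ c) (x : V) : #(traces w r R i x) ≤ c := by
  obtain ⟨z, hz, hzmin⟩ : ∃ z, prevRel R i x z ∧ ∀ y, prevRel R i x y → w z ≤ w y := by
    obtain ⟨_, ⟨z, hz, rfl⟩, hmin⟩ := exists_least (P := fun a ↦ ∃ z, prevRel R i x z ∧ w z = a)
      ⟨_, x, Or.inl rfl, rfl⟩
    exact ⟨z, hz, fun y hy ↦ hmin _ ⟨y, hy, rfl⟩⟩
  refine (mk_le_mk_of_subset (t := {{y | r y x ∧ ¬ prevRel R i x y}} ∪
    (fun j ↦ {y | r y x ∧ prevRel R j z y}) '' Iic i) ?_).trans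
    (card_union_le hc ?_ (mk_image_le.trans hi))
  · rintro N (rfl | ⟨z', j, h1, h2, h3, -, rfl⟩)
    · exact Or.inl rfl
    · have : z' = z := hw (le_antisymm (h2 z hz) (hzmin z' h1))
      subst this
      exact Or.inr ⟨j, h3, rfl⟩
  · rw [mk_singleton]
    exact one_lt_aleph0.le.trans hc

theorem exists_stages (hA : Ambient κ) (hX : StationaryListColorable X κ)
    (hAP : ApproachabilityAssumption.{u}) (hr : Orientation X κ r)
    (w : V → Cardinal.{u}) (E : (V → Set (Set V)) → V → Set (T κ)) :
    ∃ R : T (succ κ) → V → V → Prop, (∀ i, Equivalence (R i)) ∧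
      (∀ i j, i ≤ j → ∀ x y, R i x y → R j x y) ∧ (∀ i x, #{y | R i x y} ≤ succ κ) ∧
      ∀ i x t, #((fun y ↦ next (E (traces w r R i) y) t) '' {y | r y x ∧ ¬ R i x y}) ≤ κ := by
  have hΩ : RegularOrder (succ (succ κ)) (T (succ κ)) :=
    regularOrder_toType (isRegular_succ hA.inf') (hA.unc'.trans (lt_succ _))
  -- The requirement is conditional on the earlier relations being good, so that the recursion can
  -- continue with the full relation otherwise; `hgood` then shows that this default is never
  -- relevant.
  obtain ⟨R, hR⟩ := exists_rec (wellFounded_lt (α := T (succ κ)))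
    (P := fun i R b ↦ Equivalence (prevRel R i) → (∀ x, #{y | prevRel R i x y} ≤ succ κ) →
      Equivalence b ∧ (∀ x y, prevRel R i x y → b x y) ∧ (∀ x, #{y | b x y} ≤ succ κ) ∧
      ∀ x t, #((fun y ↦ next (E (traces w r R i) y) t) '' {y | r y x ∧ ¬ b x y}) ≤ κ)
    (fun i f g b hfg h ↦ by rwa [← prevRel_congr hfg, ← traces_congr hfg]) (fun i R ↦ by
      by_cases h1 : Equivalence (prevRel R i)
      · by_cases h2 : ∀ x, #{y | prevRel R i x y} ≤ succ κ
        · obtain ⟨b, hb1, hb2, hb3, hb4⟩ := thinPartition hA hX hAP hr h1 h2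
            (fun t y ↦ next (E (traces w r R i) y) t) Set.univ
          refine ⟨b, fun _ _ ↦ ⟨hb1, fun x y ↦ hb2 x trivial y trivial, fun x ↦ ?_, fun x t ↦ ?_⟩⟩
          · simpa using hb3 x trivial
          · simpa using hb4 x trivial t
        · exact ⟨fun _ _ ↦ True, fun _ h ↦ (h2 h).elim⟩
      · exact ⟨fun _ _ ↦ True, fun h ↦ (h1 h).elim⟩)
  have hgood : ∀ i, Equivalence (R i) ∧ (∀ x y, prevRel R i x y → R i x y) ∧
      (∀ x, #{y | R i x y} ≤ succ κ) ∧
      ∀ x t, #((fun y ↦ next (E (traces w r R i) y) t) '' {y | r y x ∧ ¬ R i x y}) ≤ κ := by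
    intro i
    induction i using WellFoundedLT.induction with | _ i ih
    refine hR i ⟨fun x ↦ Or.inl rfl, ?_, ?_⟩ fun x ↦ ?_
    · rintro x y (rfl | ⟨j, hj, h⟩)
      · exact Or.inl rfl
      · exact Or.inr ⟨j, hj, (ih j hj).1.symm h⟩
    · rintro x y z (rfl | ⟨j, hj, h⟩) (rfl | ⟨k, hk, h'⟩)
      · exact Or.inl rfl
      · exact Or.inr ⟨k, hk, h'⟩
      · exact Or.inr ⟨j, hj, h⟩
      · rcases lt_trichotomy j k with hjk | rfl | hjk
        · exact Or.inr ⟨k, hk, (ih k hk).1.trans ((ih k hk).2.1 _ _ (Or.inr ⟨j, hjk, h⟩)) h'⟩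
        · exact Or.inr ⟨j, hj, (ih j hj).1.trans h h'⟩
        · exact Or.inr ⟨j, hj, (ih j hj).1.trans h ((ih j hj).2.1 _ _ (Or.inr ⟨k, hjk, h'⟩))⟩
    · refine (mk_le_mk_of_subset (t := {x} ∪ ⋃ j ∈ Iio i, {y | R j x y}) ?_).trans
        (card_union_le hA.inf' ?_ (card_biUnion_le hA.inf' (lt_succ_iff.1 (hΩ.card_Iio i))
          fun j hj ↦ (ih j hj).2.2.1 x))
      · rintro y (rfl | ⟨j, hj, h⟩)
        · exact Or.inl rfl
        · exact Or.inr (mem_biUnion hj h)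
      · rw [mk_singleton]
        exact one_lt_aleph0.le.trans hA.inf'
  refine ⟨R, fun i ↦ (hgood i).1, fun i j hij x y h ↦ ?_, fun i ↦ (hgood i).2.2.1,
    fun i ↦ (hgood i).2.2.2⟩
  rcases hij.lt_or_eq with hlt | rfl
  · exact (hgood j).2.1 x y (Or.inr ⟨i, hlt, h⟩)
  · exact h

/-- An increasing chain of equivalence relations with small classes, and ladders that are almost
disjoint from the lower neighbours outside the class in the limit, and from the lower neighbours in
thin initial parts of the class. -/
theorem exists_stable_system (hA : Ambient κ) (hX : StationaryListColorable X κ)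
    (hAP : ApproachabilityAssumption.{u}) (hr : Orientation X κ r)
    {w : V → Cardinal.{u}} (hw : Function.Injective w) {L : V → Set (T κ)}
    (hL : ∀ v, IsStationary (L v)) :
    ∃ (R : T (succ κ) → V → V → Prop) (E : V → Set (T κ)), (∀ i, Equivalence (R i)) ∧
      (∀ i j, i ≤ j → ∀ x y, R i x y → R j x y) ∧ (∀ i x, #{y | R i x y} ≤ succ κ) ∧
      (∀ x, E x ⊆ L x ∧ Ladder (E x)) ∧
      (∀ x, ∃ b, ∀ ξ ∈ E x, ∀ y, r y x → (∀ i, ¬ R i x y) → ξ ∈ E y → ξ ≤ b) ∧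
      ∀ x z m, (∃ i, R i x z) → (∀ i y, R i x y → w z ≤ w y) → ¬ prevRel R m z x →
        (∀ t, #((fun y ↦ next (E y) t) '' {y | r y x ∧ prevRel R m z y}) ≤ κ) →
        ∃ b, ∀ ξ ∈ E x, ∀ y, r y x → prevRel R m z y → ξ ∈ E y → ξ ≤ b := by
  have hΩ : RegularOrder (succ (succ κ)) (T (succ κ)) :=
    regularOrder_toType (isRegular_succ hA.inf') (hA.unc'.trans (lt_succ _))
  obtain ⟨Ef, hEf, hEf'⟩ := exists_ladder_system hA hr.wf hL
  obtain ⟨R, hR1, hR2, hR3, hR4⟩ := exists_stages hA hX hAP hr w Ef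
  have htr : ∀ i x, #(traces w r R i x) ≤ succ κ := fun i x ↦
    card_traces hA.inf' hw (lt_succ_iff.1 (hΩ.card_Iic i)) x
  -- the least element of the class in the limit
  have hlead : ∀ x, ∃ z, (∃ i, R i x z) ∧ ∀ i y, R i x y → w z ≤ w y := by
    intro x
    obtain ⟨i₀⟩ := hΩ.nonempty
    obtain ⟨_, ⟨z, hz, rfl⟩, hmin⟩ := exists_least (P := fun a ↦ ∃ z, (∃ i, R i x z) ∧ w z = a)
      ⟨_, x, ⟨i₀, (hR1 i₀).refl x⟩, rfl⟩
    exact ⟨z, hz, fun i y hy ↦ hmin _ ⟨y, ⟨i, hy⟩, rfl⟩⟩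
  have hprevR : ∀ i x y, prevRel R i x y → ∃ j, R j x y := by
    rintro i x y (rfl | ⟨j, -, h⟩)
    · exact ⟨i, (hR1 i).refl x⟩
    · exact ⟨j, h⟩
  have hprevR' : ∀ i x y, prevRel R i x y → R i x y := by
    rintro i x y (rfl | ⟨j, hj, h⟩)
    · exact (hR1 i).refl x
    · exact hR2 j i hj.le x y h
  -- stages by which the data at `x` are settled
  have hsettled : ∀ x, ∃ i₀, ∀ i, i₀ ≤ i →
      (∀ y, r y x → (∃ j, R j x y) → prevRel R i x y) ∧
      ∀ z, (∃ j, R j x z) → (∀ j y, R j x y → w z ≤ w y) → prevRel R i x z := by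
    intro x
    obtain ⟨z, ⟨iz, hiz⟩, hz⟩ := hlead x
    have h1 : ∀ y, ∃ i, (∃ j, R j x y) → R i x y := by
      intro y
      by_cases h : ∃ j, R j x y
      · obtain ⟨j, hj⟩ := h
        exact ⟨j, fun _ ↦ hj⟩
      · exact ⟨iz, fun h' ↦ (h h').elim⟩
    choose i hi using h1
    obtain ⟨b, hb⟩ := hΩ.exists_gt_range (ι := {y | r y x}) (lt_succ_of_le (hr.card x))
      fun y ↦ i y
    obtain ⟨b', hb'⟩ := hΩ.exists_gt' (max b iz)
    refine ⟨b', fun k hk ↦ ⟨fun y hy hxy ↦ Or.inr ⟨i y, ?_, hi y hxy⟩, fun z' hz' hmin ↦ ?_⟩⟩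
    · exact (hb ⟨y, hy⟩).trans ((le_max_left _ _).trans_lt (hb'.trans_le hk))
    · obtain ⟨j, hj⟩ := hz'
      have : z' = z := hw (le_antisymm (hmin _ _ hiz) (hz _ _ hj))
      subst this
      exact Or.inr ⟨iz, (le_max_right _ _).trans_lt (hb'.trans_le hk), hiz⟩
  choose s hs using hsettled
  have htraces : ∀ x i, s x ≤ i → traces w r R i x = {N | N = {y | r y x ∧ ∀ j, ¬ R j x y} ∨
      ∃ z j, (∃ i, R i x z) ∧ (∀ i y, R i x y → w z ≤ w y) ∧ ¬ prevRel R j z x ∧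
        N = {y | r y x ∧ prevRel R j z y}} := by
    intro x i hi
    have h1 : {y | r y x ∧ ¬ prevRel R i x y} = {y | r y x ∧ ∀ j, ¬ R j x y} := by
      ext y
      refine and_congr_right fun hy ↦ ?_
      rw [← not_exists, not_iff_not]
      exact ⟨hprevR i x y, (hs x i hi).1 y hy⟩
    ext N
    simp only [traces, h1, mem_ofPred_eq]
    refine or_congr Iff.rfl (exists_congr fun z ↦ exists_congr fun j ↦ ?_)
    constructor
    · rintro ⟨h2, h3, -, h5, h6⟩
      refine ⟨hprevR _ _ _ h2, fun k y hk ↦ ?_, h5, h6⟩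
      obtain ⟨z', hz', hmin⟩ := hlead x
      exact (h3 z' ((hs x i hi).2 z' hz' hmin)).trans (hmin k y hk)
    · rintro ⟨h2, h3, h5, h6⟩
      have h7 := (hs x i hi).2 z h2 h3
      refine ⟨h7, fun y hy ↦ ?_, le_of_not_gt fun hlt ↦ h5 ?_, h5, h6⟩
      · obtain ⟨k, hk⟩ := hprevR _ _ _ hy
        exact h3 k y hk
      · exact Or.inr ⟨i, hlt, (hR1 i).symm (hprevR' i x z h7)⟩
  -- Once the traces at `x` and the ladders of its at most `κ⁺` lower neighbours are settled,
  -- locality of the construction freezes the ladder at `x`. Regularity of `κ⁺⁺` bounds the stages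
  -- involved.
  have hstable : ∀ x, ∃ i₀, ∀ i, i₀ ≤ i →
      Ef (traces w r R i) x = Ef (traces w r R i₀) x := by
    intro x
    induction x using hr.wf.induction with | _ x ih
    have ih' : ∀ y, ∃ i₀, r y x → ∀ i, i₀ ≤ i →
        Ef (traces w r R i) y = Ef (traces w r R i₀) y := by
      intro y
      by_cases hy : r y x
      · obtain ⟨i, hi⟩ := ih y hy
        exact ⟨i, fun _ ↦ hi⟩
      · exact ⟨s x, fun h ↦ (hy h).elim⟩
    choose i hi using ih'
    obtain ⟨b, hb⟩ := hΩ.exists_gt_range (ι := {y | r y x}) (lt_succ_of_le (hr.card x))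
      fun y ↦ i y
    refine ⟨max b (s x), fun k hk ↦ hEf' _ _ x ?_ fun y hy ↦ ?_⟩
    · rw [htraces x k ((le_max_right _ _).trans hk), htraces x _ (le_max_right _ _)]
    · have h1 : i y ≤ max b (s x) := (hb ⟨y, hy⟩).le.trans (le_max_left _ _)
      rw [hi y hy k (h1.trans hk), hi y hy _ h1]
  choose e he using hstable
  -- a common stage for `x` and its lower neighbours
  have hcommon : ∀ x, ∃ i, s x ≤ i ∧ e x ≤ i ∧ ∀ y, r y x → e y ≤ i := by
    intro x
    obtain ⟨b, hb⟩ := hΩ.exists_gt_range (ι := {y | r y x}) (lt_succ_of_le (hr.card x))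
      fun y ↦ e y
    exact ⟨max b (max (s x) (e x)), (le_max_left _ _).trans (le_max_right _ _),
      (le_max_right _ _).trans (le_max_right _ _), fun y hy ↦ (hb ⟨y, hy⟩).le.trans (le_max_left _ _)⟩
  have hE0 : ∀ x, Ef (traces w r R (e x)) x ⊆ L x ∧ Ladder (Ef (traces w r R (e x)) x) :=
    fun x ↦ ⟨(hEf _ x (htr _ x)).1, (hEf _ x (htr _ x)).2.1⟩
  have hmain : ∀ x, ∃ i, s x ≤ i ∧ (∀ y, r y x →
      Ef (traces w r R i) y = Ef (traces w r R (e y)) y) ∧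
      ∀ N ∈ traces w r R i x, (∀ y ∈ N, r y x) →
      (∀ t, #((fun y ↦ next (Ef (traces w r R (e y)) y) t) '' N) ≤ κ) →
      ∃ b, ∀ ξ ∈ Ef (traces w r R (e x)) x, ∀ y ∈ N,
        ξ ∈ Ef (traces w r R (e y)) y → ξ ≤ b := by
    intro x
    obtain ⟨i, hsi, hei, hi⟩ := hcommon x
    have hEy : ∀ y, r y x → Ef (traces w r R i) y = Ef (traces w r R (e y)) y :=
      fun y hy ↦ he y i (hi y hy)
    refine ⟨i, hsi, hEy, fun N hN hNr hthin ↦ ?_⟩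
    obtain ⟨b, hb⟩ := (hEf _ x (htr i x)).2.2 N hN (by
      have h1 : {y ∈ N | r y x} = N := sep_eq_self_iff_mem_true.2 hNr
      rw [h1]
      have h2 : ⋃ y ∈ N, Ef (traces w r R i) y = ⋃ y ∈ N, Ef (traces w r R (e y)) y :=
        iUnion₂_congr fun y hy ↦ hEy y (hNr y hy)
      rw [h2]
      exact hA.roT.not_isStationary_of_thin (fun y _ ↦ (hE0 y).2) fun t ↦ lt_succ_of_le (hthin t))
    refine ⟨b, fun ξ hξ y hy hξy ↦ hb ξ ?_ y hy (hNr y hy) ?_⟩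
    · rwa [he x i hei]
    · rwa [hEy y (hNr y hy)]
  refine ⟨R, fun x ↦ Ef (traces w r R (e x)) x, hR1, hR2, hR3, hE0, fun x ↦ ?_,
    fun x z m hz hmin hm hthin ↦ ?_⟩
  · obtain ⟨i, hi, hEy, hb⟩ := hmain x
    obtain ⟨b, hb⟩ := hb {y | r y x ∧ ∀ j, ¬ R j x y} (by rw [htraces x i hi]; exact Or.inl rfl)
      (fun y hy ↦ hy.1) fun t ↦ by
        refine (mk_le_mk_of_subset ?_).trans (hR4 i x t)
        rintro _ ⟨y, hy, rfl⟩
        exact ⟨y, ⟨hy.1, hy.2 i⟩, by simp only [hEy y hy.1]⟩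
    exact ⟨b, fun ξ hξ y hy hxy hξy ↦ hb ξ hξ y ⟨hy, hxy⟩ hξy⟩
  · obtain ⟨i, hi, -, hb⟩ := hmain x
    obtain ⟨b, hb⟩ := hb {y | r y x ∧ prevRel R m z y} (by
      rw [htraces x i hi]; exact Or.inr ⟨z, m, hz, hmin, hm, rfl⟩) (fun y hy ↦ hy.1) hthin
    exact ⟨b, fun ξ hξ y hy hxy hξy ↦ hb ξ hξ y ⟨hy, hxy⟩ hξy⟩

end

/-! ### Cells and the coloring for `κ⁺`. -/

section
variable {κ : Cardinal.{u}} {V : Type u} {X : SimpleGraph V} {r : V → V → Prop}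

/-- Values can be chosen in unbounded subsets of `κ⁺` injectively on each cell of a partition into
cells of size at most `κ⁺`. -/
theorem exists_injOn_cells (hA : Ambient κ) {ι : Type*} (cell : V → ι)
    (hcell : ∀ x, #{y | cell y = cell x} ≤ succ κ) (Q : V → Set (T κ))
    (hQ : ∀ x a, ∃ ξ ∈ Q x, a < ξ) :
    ∃ f : V → T κ, (∀ x, f x ∈ Q x) ∧ ∀ x y, cell x = cell y → f x = f y → x = y := by
  have he : ∀ j, ∃ e : V → T κ, InjOn e {y | cell y = j} := by
    intro j
    classical
    have : Nonempty (T κ) := hA.roT.nonempty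
    by_cases hj : ∃ x, cell x = j
    · obtain ⟨x, rfl⟩ := hj
      obtain ⟨e⟩ : Nonempty ({y | cell y = cell x} ↪ T κ) := by
        have : #{y | cell y = cell x} ≤ #(T κ) := by rw [hA.roT.card_eq]; exact hcell x
        exact this
      refine ⟨fun v ↦ if h : v ∈ {y | cell y = cell x} then e ⟨v, h⟩ else Classical.arbitrary _,
        fun a ha b hb hab ↦ ?_⟩
      simp only [ha, hb, dite_true, e.injective.eq_iff] at hab
      exact congrArg Subtype.val hab
    · exact ⟨fun _ ↦ Classical.arbitrary _, fun a ha ↦ (hj ⟨a, ha⟩).elim⟩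
  choose e he using he
  obtain ⟨f, hf⟩ := exists_greedy (r := fun y x ↦ cell y = cell x ∧ e (cell y) y < e (cell x) x)
    (Subrelation.wf (fun h ↦ h.2) (InvImage.wf (fun y ↦ e (cell y) y) wellFounded_lt)) Q
    fun x ↦ by
      rw [hA.roT.card_of_cofinal (hQ x)]
      refine lt_of_le_of_lt ?_ (hA.roT.card_Iio (e (cell x) x))
      refine mk_le_of_injective (f := fun y ↦ ⟨e (cell y.1) y.1, y.2.2⟩) ?_
      rintro ⟨a, ha, ha'⟩ ⟨b, hb, hb'⟩ hab
      have hab' : e (cell a) a = e (cell b) b := congrArg Subtype.val hab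
      rw [ha, hb] at hab'
      exact Subtype.ext (he (cell x) ha hb hab')
  refine ⟨f, fun x ↦ (hf x).1, fun x y hxy hfxy ↦ ?_⟩
  by_contra hne
  rcases lt_trichotomy (e (cell x) x) (e (cell y) y) with h | h | h
  · exact (hf y).2 x ⟨hxy, h⟩ hfxy
  · rw [hxy] at h
    exact hne (he (cell y) hxy rfl h)
  · exact (hf x).2 y ⟨hxy.symm, h⟩ hfxy.symm

theorem stationaryListColorable_succ (hA : Ambient κ) (hX : StationaryListColorable X κ)
    (hAP : ApproachabilityAssumption.{u}) : StationaryListColorable X (succ κ) := by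
  classical
  obtain ⟨r, hr⟩ := exists_orientation hA hX
  intro L hL
  have hΩreg : (succ (succ κ)).IsRegular := isRegular_succ hA.inf'
  have hΩ : RegularOrder (succ (succ κ)) (T (succ κ)) :=
    regularOrder_toType hΩreg (hA.unc'.trans (lt_succ _))
  obtain ⟨i₀⟩ := hΩ.nonempty
  obtain ⟨R, E, hR1, hR2, hR3, hE, hE1, hE2⟩ :=
    exists_stable_system hA hX hAP hr (w := embeddingToCardinal) embeddingToCardinal.injective hL
  -- leaders of the limit classes
  have hlead : ∀ x, ∃ z, (∃ i, R i x z) ∧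
      ∀ i y, R i x y → embeddingToCardinal z ≤ embeddingToCardinal y := by
    intro x
    obtain ⟨_, ⟨z, hz, rfl⟩, hmin⟩ := exists_least
      (P := fun a ↦ ∃ z, (∃ i, R i x z) ∧ embeddingToCardinal z = a)
      ⟨_, x, ⟨i₀, (hR1 i₀).refl x⟩, rfl⟩
    exact ⟨z, hz, fun i y hy ↦ hmin _ ⟨y, ⟨i, hy⟩, rfl⟩⟩
  choose z hz hzmin using hlead
  have hz' : ∀ x, ∃ i, R i (z x) x := fun x ↦ (hz x).imp fun i h ↦ (hR1 i).symm h
  have hclass : ∀ x y, (∃ i, R i x y) → z x = z y := by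
    rintro x y ⟨i, hxy⟩
    refine embeddingToCardinal.injective (le_antisymm ?_ ?_)
    · obtain ⟨j, hj⟩ := hz y
      exact hzmin x (max i j) _ ((hR1 _).trans (hR2 _ _ (le_max_left _ _) _ _ hxy)
        (hR2 _ _ (le_max_right _ _) _ _ hj))
    · obtain ⟨j, hj⟩ := hz x
      exact hzmin y (max i j) _ ((hR1 _).trans (hR2 _ _ (le_max_left _ _) _ _ ((hR1 i).symm hxy))
        (hR2 _ _ (le_max_right _ _) _ _ hj))
  have hclass' : ∀ x y, z x = z y → ∃ i, R i x y := by
    intro x y h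
    obtain ⟨i, hi⟩ := hz x
    obtain ⟨j, hj⟩ := hz' y
    exact ⟨max i j, (hR1 _).trans (hR2 _ _ (le_max_left _ _) _ _ hi)
      (hR2 _ _ (le_max_right _ _) _ _ (h ▸ hj))⟩
  -- the stage at which a vertex joins the class of its leader
  have hrank : ∀ x, ∃ j, R j (z x) x ∧ ∀ k, R k (z x) x → j ≤ k := fun x ↦ exists_least (hz' x)
  choose ρ hρ hρmin using hrank
  have hsmall : ∀ x δ, #{y ∈ {y | z y = z x} | ρ y < δ} < succ (succ κ) := by
    intro x δ
    refine lt_succ_of_le ((mk_le_mk_of_subset ?_).trans (hR3 δ (z x)))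
    rintro y ⟨hy, hyδ⟩
    have := hR2 _ _ hyδ.le _ _ (hρ y)
    rwa [show z y = z x from hy] at this
  have hD : ∀ x, ∃ D : Set (T (succ κ)), IsClub D ∧
      (∀ d ∈ D, ∀ v, z v = z x → d ≤ ρ v → ∀ t,
        #((fun y ↦ next (E y) t) '' {y ∈ {y | z y = z x} | X.Adj v y ∧ ρ y < d}) ≤ κ) ∧
      ∀ d ∈ D, ∀ v, z v = z x → ρ v < d → ∀ y, r y v → ρ y < d := by
    intro x
    choose D hD hD' using fun t ↦ exists_club_thin hA hX hAP hΩreg (lt_succ _) ρ {y | z y = z x}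
      (hsmall x) fun y ↦ next (E y) t
    refine ⟨(⋂ t, D t) ∩ _, hΩ.isClub_inter (hΩ.isClub_iInter
      (by rw [hA.roT.card_eq]; exact lt_succ _) hD) (isClub_closed_under hΩ (lt_succ _) (hsmall x)
      (fun v ↦ {y | r y v}) hr.card), fun d hd v hv hdv t ↦ hD' t d (mem_iInter.1 hd.1 t) v hv hdv,
      fun d hd v hv hvd y hy ↦ hd.2 v hv hvd y hy⟩
  choose D hDclub hDthin hDclosed using hD
  -- Inside a limit class, cells are the intervals of the rank `ρ` cut out by a club of `κ⁺⁺`. They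
  -- are bounded in rank, hence contained in a class of some single stage.
  let cell : V → V × Set (T (succ κ)) := fun x ↦ (z x, {d ∈ D (z x) | d ≤ ρ x})
  have hzz : ∀ x, z (z x) = z x := fun x ↦ hclass _ _ (hz' x)
  have hcell : ∀ x, #{y | cell y = cell x} ≤ succ κ := by
    intro x
    obtain ⟨b, hb⟩ := hΩ.exists_gt' (ρ x)
    obtain ⟨d, hd, hbd⟩ := (hDclub (z x)).isCofinal b
    refine lt_succ_iff.1 ((mk_le_mk_of_subset ?_).trans_lt (hsmall x d))
    intro y hy
    obtain ⟨h1, h2⟩ := Prod.ext_iff.1 (show cell y = cell x from hy)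
    refine ⟨h1, ?_⟩
    by_contra! hdy
    have h3 : d ∈ {d ∈ D (z y) | d ≤ ρ y} :=
      ⟨by rw [show z y = z x from h1]; exact hd, hdy⟩
    have h4 : d ∈ {d ∈ D (z x) | d ≤ ρ x} := h2.subset h3
    exact h4.2.not_gt (hb.trans_le hbd)
  have hbound : ∀ x, ∃ b, ∀ ξ ∈ E x, ∀ y, r y x → cell y ≠ cell x → ξ ∈ E y → ξ ≤ b := by
    intro x
    obtain ⟨b₁, hb₁⟩ := hE1 x
    by_cases hcross : ∃ y, r y x ∧ z y = z x ∧ cell y ≠ cell x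
    swap
    · refine ⟨b₁, fun ξ hξ y hy hne hξy ↦ hb₁ ξ hξ y hy (fun i hi ↦ ?_) hξy⟩
      exact hcross ⟨y, hy, (hclass x y ⟨i, hi⟩).symm, hne⟩
    have key : ∀ y, r y x → z y = z x → cell y ≠ cell x → ∃ d ∈ D (z x), ρ y < d ∧ d ≤ ρ x := by
      intro y hyx hzy hne
      by_contra! hcon
      refine hne (Prod.ext hzy ?_)
      simp only [cell, hzy]
      ext d
      refine and_congr_right fun hd ↦ ⟨fun h ↦ ?_, fun h ↦ ?_⟩
      · by_contra! h'
        exact (hDclosed (z x) d hd x (hzz x).symm h' y hyx).not_ge h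
      · by_contra! h'
        exact (hcon d hd h').not_ge h
    obtain ⟨y₀, hy₀, hzy₀, hne₀⟩ := hcross
    obtain ⟨d, hd, hyd, hdx⟩ := key y₀ hy₀ hzy₀ hne₀
    obtain ⟨m, hm, hmx, hdm, hmax⟩ := RegularOrder.club_exists_max (hDclub (z x)) hd hdx
    -- The leader belongs to its own class from the first stage. Hence it lies below the cut `m`,
    -- and rank below `m` agrees with the relation `prevRel R m (z x)` also at the leader.
    have hρz : ∀ j, ρ (z x) ≤ j := fun j ↦ hρmin _ j (by rw [hzz]; exact (hR1 j).refl _)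
    have hzm : ρ (z x) < m := (hρz (ρ y₀)).trans_lt (hyd.trans_le hdm)
    have hmz : ¬ prevRel R m (z x) x := by
      rintro (h | ⟨j, hj, h⟩)
      · rw [h] at hzm
        exact hzm.not_ge hmx
      · exact ((hρmin x j h).trans_lt hj).not_ge hmx
    -- Lower neighbours in the same limit class but another cell have rank below `m`, while `x`
    -- joins at stage `m` or later. Their set is thus one of the traces respected by the ladder at
    -- `x`, and the club makes it thin.
    obtain ⟨b₂, hb₂⟩ := hE2 x (z x) m (hz x) (hzmin x) hmz fun t ↦ by
      refine (mk_le_mk_of_subset (image_mono ?_)).trans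
        (hDthin (z x) m hm x (hzz x).symm hmx t)
      rintro y ⟨hyx, rfl | ⟨j, hj, h⟩⟩
      · exact ⟨rfl, hr.adj hyx, hzm⟩
      · have h1 : z (z x) = z y := hclass _ _ ⟨j, h⟩
        refine ⟨h1.symm, hr.adj hyx, (hρmin y j ?_).trans_lt hj⟩
        rwa [← h1, hzz]
    refine ⟨max b₁ b₂, fun ξ hξ y hy hne hξy ↦ ?_⟩
    by_cases hzy : z y = z x
    · obtain ⟨d', hd', hyd', hd'x⟩ := key y hy hzy hne
      refine (hb₂ ξ hξ y hy (Or.inr ⟨ρ y, hyd'.trans_le (hmax d' hd' hd'x), ?_⟩) hξy).trans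
        (le_max_right _ _)
      rw [← hzy]
      exact hρ y
    · exact (hb₁ ξ hξ y hy (fun i hi ↦ hzy (hclass x y ⟨i, hi⟩).symm) hξy).trans (le_max_left _ _)
  choose β hβ using hbound
  obtain ⟨f, hf1, hf2⟩ := exists_injOn_cells hA cell hcell (fun x ↦ {ξ ∈ E x | β x < ξ}) fun x a ↦ by
    obtain ⟨ξ, hξ, h⟩ := (hE x).2.unbounded (max a (β x))
    exact ⟨ξ, ⟨hξ, (le_max_right _ _).trans_lt h⟩, (le_max_left _ _).trans_lt h⟩
  have hproper : ∀ x y, r y x → f x ≠ f y := by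
    intro x y hyx heq
    by_cases hc : cell y = cell x
    · exact (hr.adj hyx).ne (hf2 x y hc.symm heq)
    · exact (hβ x (f x) (hf1 x).1 y hyx hc (heq ▸ (hf1 y).1)).not_gt (hf1 x).2
  refine ⟨SimpleGraph.Coloring.mk f fun {x y} h ↦ ?_, fun v ↦ (hE v).1 (hf1 v).1⟩
  rcases hr.total h with h | h
  · exact (hproper y x h).symm
  · exact hproper x y h

end

end StatList

end

theorem mainTheorem7 (hGCH : GCH.{u}) (κ : Cardinal.{u}) (hκ : κ.IsRegular)
    (hκ_unc : Cardinal.aleph0 < κ) {V : Type u} (X : SimpleGraph V) :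
    (StationaryListColorable X κ →
      StationaryListColorable X (Order.succ (Order.succ κ))) ∧
    (ApproachabilityAssumption.{u} → StationaryListColorable X κ →
      StationaryListColorable X (Order.succ κ)) := by
  have hA : StatList.Ambient κ := ⟨hGCH, hκ, hκ_unc⟩
  exact ⟨StatList.stationaryListColorable_succ_succ hA,
    fun hAP hX ↦ StatList.stationaryListColorable_succ hA hX hAP⟩
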